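/- Let $n\equiv 2$ or $3 \pmod 4$, let $Cl_n=Cl_{n,0}$ be the real Clifford algebra of Euclidean $\mathbb R^n$ with reversion $M\mapsto\widetilde M$, modulus $|M|^2=\langle M\widetilde M\rangle_0$ and unit pseudoscalar $i_n=e_1e_2\cdots e_n$ (so $i_n^2=-1$). For $f,g\in L^2(\mathbb R^n;Cl_n)$ put $(f,g)=\int_{\mathbb R^n} f(x)\widetilde{g(x)}\,d^nx\in Cl_n$, and let $\widehat f$ be the Clifford Fourier transform, i.e. the $L^2$-extension of $\widehat f(\omega)=\int_{\mathbb R^n} f(x)e^{-i_n\omega\cdot x}\,d^nx$. Let $\mathcal G=\{(a,r_\theta,b): a>0,\ r_\theta\in SO(n),\ b\in\mathbb R^n\}$ be the similitude group with the measures $d\mu=a^{-(n+1)}\,da\,d\theta$ and $d\lambda=d\mu\,d^nb$, where $d\theta$ is a (fixed, arbitrarily normalized) Haar measure on $SO(n)$. For $\psi:\mathbb R^n\to Cl_n$ put $\psi_{a,\theta,b}(x)=a^{-n/2}\psi\big(r_\theta^{-1}((x-b)/a)\big)$. Let $\psi\in L^2(\mathbb R^n;Cl_n)$ be admissible, i.e.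 there is an invertible multivector $C_\psi\in Cl_n$ such that for almost every $\omega\in\mathbb R^n$ the integral $$\int_{\mathbb R^+}\int_{SO(n)} a^n\,\{\widehat\psi(a r_\theta^{-1}\omega)\}^{\sim}\,\widehat\psi(a r_\theta^{-1}\omega)\,d\mu$$ converges absolutely and equals $C_\psi$. If $n\equiv 2\pmod 4$, assume moreover that $\psi$ takes values in the even part $Cl_n^+$ (put $\varepsilon=1$) or in the odd part $Cl_n^-$ (put $\varepsilon=-1$); if $n\equiv 3\pmod 4$ put $\varepsilon=1$. Let $C'_\psi=\varepsilon^n C_\psi$ (which equals $C_\psi$). For $f\in L^2(\mathbb R^n;Cl_n)$ let $T_\psi f(a,\theta,b)=(f,\psi_{a,\theta,b})$, and define $$K_\psi(a,\theta,b;a',\theta',b')=\big(\psi_{a,\theta,b}\,{C'_\psi}^{-1},\ \psi_{a',\theta',b'}\big).$$ Then $K_\psi$ is a reproducing kernel in $L^2(\mathcal G,d\lambda)$: for every $f\in L^2(\mathbb R^n;Cl_n)$ one has $T_\psi f\in L^2(\mathcal G;Cl_n)$, and for every $(a',\theta',b')\in\mathcal G$ the function $K_\psi(\cdot\,;a',\theta',b')$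 belongs to $L^2(\mathcal G;Cl_n)$, the function $T_\psi f(\cdot)\,K_\psi(\cdot\,;a',\theta',b')$ is integrable over $\mathcal G$, and $$T_\psi f(a',\theta',b')=\int_{\mathcal G}T_\psi f(a,\theta,b)\,K_\psi(a,\theta,b;a',\theta',b')\,d\lambda(a,\theta,b).$$ -/

import Mathlib

open MeasureTheory Filter Topology

noncomputable section

namespace CliffordWavelet

/-- Euclidean space `ℝⁿ`. -/
abbrev E (n : ℕ) : Type := EuclideanSpace ℝ (Fin n)

/-- The quadratic form `Q(x) = x · x` on `ℝⁿ`. -/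
abbrev Q (n : ℕ) : QuadraticForm ℝ (E n) := LinearMap.BilinMap.toQuadraticMap (innerₗ (E n))

/-- The Clifford algebra `Cl_n = Cl_{n,0}`. -/
abbrev Cl (n : ℕ) : Type := CliffordAlgebra (Q n)

/-- The vector `e_i` of the standard orthonormal basis, as an element of `Cl_n`. -/
def vec (n : ℕ) (i : Fin n) : Cl n := CliffordAlgebra.ι (Q n) (EuclideanSpace.single i (1 : ℝ))

/-- The unit pseudoscalar `i_n = e_1 e_2 ⋯ e_n`. -/
def pseudoscalar (n : ℕ) : Cl n := (List.ofFn (vec n)).prod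

/-- The scalar part `⟨M⟩₀`: the degree-zero component of `M` under the canonical linear
identification of the Clifford algebra with the exterior algebra. -/
def scalarPart (n : ℕ) : Cl n →ₗ[ℝ] ℝ :=
  (ExteriorAlgebra.algebraMapInv (R := ℝ) (M := E n)).toLinearMap ∘ₗ
    (CliffordAlgebra.equivExterior (Q n)).toLinearMap

/-! The scalar product `⟨M Ñ⟩₀` is an inner product, for which the blades `e_A` form an orthonormal
basis; the associated norm is the modulus `|M|`. -/

/-- The product `e_{i_1} ⋯ e_{i_k}` along a list of indices. -/
def word (n : ℕ) (l : List (Fin n)) : Cl n := (l.map (vec n)).prod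

/-- The blade `e_A`, factors in increasing order. -/
def blade (n : ℕ) (A : Finset (Fin n)) : Cl n := word n (A.sort (· ≤ ·))

theorem vec_mul_self (n : ℕ) (i : Fin n) : vec n i * vec n i = 1 := by
  simp [vec, CliffordAlgebra.ι_sq_scalar]

theorem vec_mul_vec (n : ℕ) {i j : Fin n} (h : i ≠ j) :
    vec n i * vec n j = -(vec n j * vec n i) := by
  rw [eq_neg_iff_add_eq_zero]
  unfold vec
  rw [CliffordAlgebra.ι_mul_ι_add_swap]
  simp [QuadraticMap.polar, inner_add_right, EuclideanSpace.inner_single_left,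
    h, h.symm]

theorem vec_mul_word (n : ℕ) (i : Fin n) (l : List (Fin n)) (hl : l.Pairwise (· < ·)) :
    ∃ l' : List (Fin n), l'.Pairwise (· < ·) ∧ (∀ j, j ∈ l' ↔ Xor (j = i) (j ∈ l)) ∧
      (vec n i * word n l = word n l' ∨ vec n i * word n l = -word n l') := by
  induction l with
  | nil => exact ⟨[i], by simp, by simp [Xor], Or.inl (by simp [word])⟩
  | cons a t ih =>
    rw [List.pairwise_cons] at hl
    obtain ⟨hat, ht⟩ := hl
    rcases lt_trichotomy i a with h | h | h
    · refine ⟨i :: a :: t, ?_, ?_, Or.inl (by simp [word])⟩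
      · simp only [List.pairwise_cons, List.mem_cons]
        exact ⟨fun b hb => hb.elim (fun e => e ▸ h) (fun hb => h.trans (hat b hb)), hat, ht⟩
      · intro j
        have h1 : i ≠ a := h.ne
        have h2 : i ∉ t := fun hi => absurd (hat i hi) (not_lt.mpr h.le)
        simp only [List.mem_cons, Xor]
        grind
    · subst h
      refine ⟨t, ht, ?_, Or.inl (by simp [word, ← mul_assoc, vec_mul_self])⟩
      intro j
      have h2 : i ∉ t := fun hi => lt_irrefl _ (hat i hi)
      simp only [List.mem_cons, Xor]
      grind
    · obtain ⟨t', ht', hm, hs⟩ := ih ht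
      refine ⟨a :: t', ?_, ?_, ?_⟩
      · rw [List.pairwise_cons]
        refine ⟨fun b hb => ?_, ht'⟩
        rcases (hm b).1 hb with ⟨e, -⟩ | ⟨hb, -⟩
        · exact e ▸ h
        · exact hat b hb
      · intro j
        have h1 : i ≠ a := h.ne'
        have h2 : a ∉ t := fun hi => lt_irrefl _ (hat a hi)
        have := hm j
        simp only [List.mem_cons, Xor] at this ⊢
        grind
      · have e1 : vec n i * word n (a :: t) = -(vec n a * (vec n i * word n t)) := by
          simp only [word, List.map_cons, List.prod_cons]
          rw [← mul_assoc, vec_mul_vec n h.ne', neg_mul, mul_assoc]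
        have e2 : word n (a :: t') = vec n a * word n t' := by simp [word]
        rw [e1, e2]
        rcases hs with hs | hs <;> rw [hs] <;> simp

theorem equivExterior_word (n : ℕ) (l : List (Fin n)) (hl : l.Nodup) :
    CliffordAlgebra.equivExterior (Q n) (word n l) =
      (l.map fun i => ExteriorAlgebra.ι ℝ (EuclideanSpace.single i (1 : ℝ) : E n)).prod := by
  have key : ∀ (i : Fin n) (l : List (Fin n)), i ∉ l →
      CliffordAlgebra.contractLeft (Q := (0 : QuadraticForm ℝ (E n)))
        ((QuadraticMap.associated (R := ℝ) (-(Q n))) (EuclideanSpace.single i (1 : ℝ)))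
      (l.map fun i => CliffordAlgebra.ι (0 : QuadraticForm ℝ (E n))
        (EuclideanSpace.single i (1 : ℝ) : E n)).prod = 0 := by
    intro i l
    induction l with
    | nil => simp
    | cons a t ih =>
      intro h
      simp only [List.mem_cons, not_or] at h
      simp only [List.map_cons, List.prod_cons]
      rw [CliffordAlgebra.contractLeft_ι_mul, ih h.2]
      simp [QuadraticMap.associated_apply, inner_add_right,
        EuclideanSpace.inner_single_left, h.1, Ne.symm h.1]
  induction l with
  | nil => simp [word, CliffordAlgebra.equivExterior]
  | cons a t ih =>
    rw [List.nodup_cons] at hl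
    have e : word n (a :: t) = vec n a * word n t := by simp [word]
    have ih' := ih hl.2
    rw [e, List.map_cons, List.prod_cons]
    unfold CliffordAlgebra.equivExterior at ih' ⊢
    rw [CliffordAlgebra.changeFormEquiv_apply] at ih' ⊢
    unfold vec
    rw [CliffordAlgebra.changeForm_ι_mul, ih']
    have := key a t hl.1
    erw [this]
    rw [sub_zero]

theorem scalarPart_word (n : ℕ) (l : List (Fin n)) (hl : l.Nodup) :
    scalarPart n (word n l) = if l = [] then 1 else 0 := by
  simp only [scalarPart, LinearMap.comp_apply, LinearEquiv.coe_coe, equivExterior_word n l hl]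
  cases l with
  | nil => simp
  | cons a t => simp [ExteriorAlgebra.algebraMapInv]

theorem word_mul_word (n : ℕ) (k l : List (Fin n)) (hk : k.Nodup) (hl : l.Pairwise (· < ·)) :
    ∃ l' : List (Fin n), l'.Pairwise (· < ·) ∧ (∀ j, j ∈ l' ↔ Xor (j ∈ k) (j ∈ l)) ∧
      (word n k * word n l = word n l' ∨ word n k * word n l = -word n l') := by
  induction k with
  | nil => exact ⟨l, hl, by simp [Xor], Or.inl (by simp [word])⟩
  | cons a t ih =>
    rw [List.nodup_cons] at hk
    obtain ⟨m, hm, hmem, hs⟩ := ih hk.2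
    obtain ⟨m', hm', hmem', hs'⟩ := vec_mul_word n a m hm
    refine ⟨m', hm', fun j => ?_, ?_⟩
    · have h1 := hmem j
      have h2 := hmem' j
      have h3 := hk.1
      simp only [List.mem_cons, Xor] at *
      grind
    · have e : word n (a :: t) = vec n a * word n t := by simp [word]
      rw [e, mul_assoc]
      rcases hs with hs | hs <;> rcases hs' with hs' | hs' <;> simp [hs, hs']

theorem reverse_word (n : ℕ) (l : List (Fin n)) :
    CliffordAlgebra.reverse (word n l) = word n l.reverse := by
  induction l with
  | nil => simp [word]
  | cons a t ih =>
    have e : word n (a :: t) = vec n a * word n t := by simp [word]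
    rw [e, CliffordAlgebra.reverse.map_mul, ih]
    simp [word, vec]

theorem word_mul_reverse (n : ℕ) (l : List (Fin n)) : word n l * word n l.reverse = 1 := by
  induction l with
  | nil => simp [word]
  | cons a t ih =>
    have e : word n (a :: t) = vec n a * word n t := by simp [word]
    have e' : word n (a :: t).reverse = word n t.reverse * vec n a := by simp [word]
    rw [e, e', mul_assoc, ← mul_assoc (word n t), ih, one_mul, vec_mul_self]

/-- The blades `e_A` are orthonormal for `⟨M Ñ⟩₀`. -/
theorem scalarPart_blade_mul_reverse (n : ℕ) (A B : Finset (Fin n)) :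
    scalarPart n (blade n A * CliffordAlgebra.reverse (blade n B)) = if A = B then 1 else 0 := by
  have h1 : scalarPart n 1 = 1 := by simpa [word] using scalarPart_word n [] List.nodup_nil
  unfold blade
  rw [reverse_word]
  split_ifs with h
  · subst h
    rw [word_mul_reverse, h1]
  · set a := A.sort (· ≤ ·) with ha
    set b := B.sort (· ≤ ·) with hb
    have hbs : b.Pairwise (· < ·) := (B.sortedLT_sort).pairwise
    have hbn : b.Nodup := B.sort_nodup _
    have hbr : word n b.reverse = word n b ∨ word n b.reverse = -word n b := by
      obtain ⟨m, -, hm, hs⟩ := word_mul_word n b b hbn hbs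
      have : m = [] := by
        rw [List.eq_nil_iff_forall_not_mem]
        intro j hj
        simpa [Xor] using (hm j).1 hj
      subst this
      have hone : word n b.reverse * word n b = 1 := by
        simpa using word_mul_reverse n b.reverse
      have h2 : word n b.reverse * (word n b * word n b) = word n b := by
        rw [← mul_assoc, hone, one_mul]
      rcases hs with hs | hs <;> rw [hs] at h2
      · left; simpa [word] using h2
      · right; rw [← h2]; simp [word]
    obtain ⟨m, hm, hmem, hs⟩ := word_mul_word n a b (A.sort_nodup _) hbs
    have hne : m ≠ [] := by
      rintro rfl
      apply h
      ext j
      have := hmem j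
      simp only [List.not_mem_nil, Xor, ha, hb, Finset.mem_sort] at this
      grind
    have h0 : scalarPart n (word n m) = 0 := by
      rw [scalarPart_word n m (hm.imp (fun h => h.ne)), if_neg hne]
    rcases hbr with hbr | hbr <;> rcases hs with hs | hs <;> simp [hbr, hs, h0]

/-- The blades `e_A` span `Cl_n`. -/
theorem span_blade (n : ℕ) : Submodule.span ℝ (Set.range (blade n)) = ⊤ := by
  have hmul : ∀ (v : E n) (x : Cl n), x ∈ Submodule.span ℝ (Set.range (blade n)) →
      CliffordAlgebra.ι (Q n) v * x ∈ Submodule.span ℝ (Set.range (blade n)) := by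
    intro v x hx
    have hv : CliffordAlgebra.ι (Q n) v = ∑ i, v i • vec n i := by
      conv_lhs => rw [← (EuclideanSpace.basisFun (Fin n) ℝ).sum_repr v]
      simp [vec]
    rw [hv, Finset.sum_mul]
    refine Submodule.sum_mem _ fun i _ => ?_
    rw [smul_mul_assoc]
    refine Submodule.smul_mem _ _ ?_
    induction hx using Submodule.span_induction with
    | mem y hy =>
      obtain ⟨A, rfl⟩ := hy
      obtain ⟨m, hm, -, hs⟩ := vec_mul_word n i (A.sort (· ≤ ·)) (A.sortedLT_sort).pairwise
      have hmem : word n m ∈ Submodule.span ℝ (Set.range (blade n)) := by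
        refine Submodule.subset_span ⟨m.toFinset, ?_⟩
        have : m.toFinset.sort (· ≤ ·) = m :=
          (List.toFinset_sort (· ≤ ·) (hm.imp fun h => h.ne)).2 (hm.imp fun h => h.le)
        rw [blade, this]
      unfold blade
      rcases hs with hs | hs <;> rw [hs]
      · exact hmem
      · exact Submodule.neg_mem _ hmem
    | zero => simp
    | add y z _ _ h1 h2 => rw [mul_add]; exact Submodule.add_mem _ h1 h2
    | smul c y _ h => rw [mul_smul_comm]; exact Submodule.smul_mem _ _ h
  have h1 : (1 : Cl n) ∈ Submodule.span ℝ (Set.range (blade n)) :=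
    Submodule.subset_span ⟨∅, by simp [blade, word]⟩
  rw [eq_top_iff]
  intro x _
  induction x using CliffordAlgebra.left_induction with
  | algebraMap r =>
    rw [Algebra.algebraMap_eq_smul_one]; exact Submodule.smul_mem _ _ h1
  | add y z hy hz => exact Submodule.add_mem _ (hy trivial) (hz trivial)
  | ι_mul x v hx => exact hmul v x (hx trivial)

theorem exists_eq_sum_blade (n : ℕ) (M : Cl n) :
    ∃ c : Finset (Fin n) → ℝ, ∑ A, c A • blade n A = M := by
  have : M ∈ Submodule.span ℝ (Set.range (blade n)) := by rw [span_blade]; trivial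
  exact (Submodule.mem_span_range_iff_exists_fun ℝ).1 this

/-- `⟨M Ñ⟩₀ = ∑_A M_A N_A`. -/
theorem scalarPart_sum_blade (n : ℕ) (c d : Finset (Fin n) → ℝ) :
    scalarPart n ((∑ A, c A • blade n A) * CliffordAlgebra.reverse (∑ A, d A • blade n A)) =
      ∑ A, c A * d A := by
  simp [Finset.sum_mul, Finset.mul_sum, scalarPart_blade_mul_reverse, mul_comm]

/-- The inner product `M ∗ Ñ = ⟨M Ñ⟩₀` on `Cl_n`. -/
abbrev innerCore (n : ℕ) : InnerProductSpace.Core ℝ (Cl n) where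
  inner M N := scalarPart n (M * CliffordAlgebra.reverse N)
  conj_inner_symm M N := by
    obtain ⟨c, rfl⟩ := exists_eq_sum_blade n M
    obtain ⟨d, rfl⟩ := exists_eq_sum_blade n N
    simp only [scalarPart_sum_blade]
    simp [mul_comm]
  re_inner_nonneg M := by
    obtain ⟨c, rfl⟩ := exists_eq_sum_blade n M
    simp only [scalarPart_sum_blade, RCLike.re_to_real]
    exact Finset.sum_nonneg fun A _ => mul_self_nonneg (c A)
  add_left M N P := by simp [add_mul]
  smul_left M N r := by simp
  definite M h := by
    obtain ⟨c, rfl⟩ := exists_eq_sum_blade n M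
    rw [scalarPart_sum_blade,
      Finset.sum_eq_zero_iff_of_nonneg fun A _ => mul_self_nonneg (c A)] at h
    refine Finset.sum_eq_zero fun A hA => ?_
    rw [mul_self_eq_zero.1 (h A hA), zero_smul]

instance instNormedAddCommGroupCl (n : ℕ) : NormedAddCommGroup (Cl n) :=
  (innerCore n).toNormedAddCommGroup

instance instInnerProductSpaceCl (n : ℕ) : InnerProductSpace ℝ (Cl n) :=
  InnerProductSpace.ofCore (innerCore n).toCore

instance instFiniteDimensionalCl (n : ℕ) : FiniteDimensional ℝ (Cl n) :=
  ⟨(Submodule.fg_def).2 ⟨Set.range (blade n), Set.finite_range _, span_blade n⟩⟩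

/-- The `Cl_n`-valued inner product `(f, g) = ∫ f(x) g(x)~ dⁿx`. -/
def l2Inner {n : ℕ} (f g : E n → Cl n) : Cl n := ∫ x, f x * CliffordAlgebra.reverse (g x)

/-- `e^{i_n t} = cos t + i_n sin t` (used for `n ≡ 2, 3 mod 4`, where `i_n² = -1`). -/
def expI (n : ℕ) (t : ℝ) : Cl n := Real.cos t • (1 : Cl n) + Real.sin t • pseudoscalar n

/-- The Clifford Fourier integral `∫ f(x) e^{-i_n ω·x} dⁿx`, for integrable `f`. -/
def cftIntegral {n : ℕ} (f : E n → Cl n) (ω : E n) : Cl n :=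
  ∫ x, f x * expI n (-(inner ℝ ω x))

/-- `φ` is (a representative of) the Clifford Fourier transform of `f ∈ L²`: the limit in `L²` of
the Fourier integrals over the balls `|x| ≤ R`, as `R → ∞`. -/
def IsCFT {n : ℕ} (f φ : E n → Cl n) : Prop :=
  MemLp φ 2 volume ∧
    Tendsto (fun R : ℝ =>
      eLpNorm (φ - cftIntegral ((Metric.closedBall (0 : E n) R).indicator f)) 2 volume)
      atTop (𝓝 0)

open Classical in
/-- The Clifford Fourier transform of `f ∈ L²`, determined almost everywhere. -/
def cft {n : ℕ} (f : E n → Cl n) : E n → Cl n :=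
  if h : ∃ φ, IsCFT f φ then h.choose else 0

/-- The rotation group `SO(n)`. -/
abbrev SO (n : ℕ) : Type := Matrix.specialOrthogonalGroup (Fin n) ℝ

instance instMeasurableSpaceSO (n : ℕ) : MeasurableSpace (SO n) := borel (SO n)

instance instBorelSpaceSO (n : ℕ) : BorelSpace (SO n) := ⟨rfl⟩

/-- The action of a rotation on `ℝⁿ`. -/
def rotate {n : ℕ} (r : SO n) (x : E n) : E n := WithLp.toLp 2 (r.1.mulVec x.ofLp)

/-- Dilations and rotations: pairs `(a, r)` with `a > 0` and `r ∈ SO(n)`. -/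
abbrev DilRot (n : ℕ) : Type := Set.Ioi (0 : ℝ) × SO n

/-- The similitude group `SIM(n)`: triples `((a, r), b)`. -/
abbrev SIM (n : ℕ) : Type := DilRot n × E n

/-- The measure `da / a^{n+1}` on `ℝ⁺`. -/
def scaleMeasure (n : ℕ) : Measure (Set.Ioi (0 : ℝ)) :=
  ((volume : Measure ℝ).comap Subtype.val).withDensity
    fun a => ENNReal.ofReal ((a : ℝ) ^ (n + 1))⁻¹

/-- `dμ(a, θ) = da dθ / a^{n+1}`, where `dθ = ν` is the Haar measure on `SO(n)`. -/
def muMeasure {n : ℕ} (ν : Measure (SO n)) : Measure (DilRot n) := (scaleMeasure n).prod ν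

/-- The left Haar measure `dλ(a, θ, b) = dμ(a, θ) dⁿb` on `SIM(n)`. -/
def simMeasure {n : ℕ} (ν : Measure (SO n)) : Measure (SIM n) := (muMeasure ν).prod volume

/-- The daughter wavelet `ψ_{a,θ,b}(x) = a^{-n/2} ψ(r_θ⁻¹((x - b)/a))`. -/
def daughter {n : ℕ} (ψ : E n → Cl n) (g : SIM n) (x : E n) : Cl n :=
  ((g.1.1 : ℝ) ^ (-(n : ℝ) / 2)) •
    ψ (rotate g.1.2⁻¹ ((g.1.1 : ℝ)⁻¹ • (x - g.2)))

/-- The integrand `aⁿ ψ̂(a r_θ⁻¹ ω)~ ψ̂(a r_θ⁻¹ ω)` of the admissibility constant. -/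
def admissibilityIntegrand {n : ℕ} (ψ : E n → Cl n) (ω : E n) (p : DilRot n) : Cl n :=
  ((p.1 : ℝ) ^ n) •
    (CliffordAlgebra.reverse (cft ψ ((p.1 : ℝ) • rotate p.2⁻¹ ω)) *
      cft ψ ((p.1 : ℝ) • rotate p.2⁻¹ ω))

/-- `ψ` is an admissible mother wavelet with admissibility constant `C = C_ψ`: `ψ ∈ L²`, and
`∫_{ℝ⁺} ∫_{SO(n)} aⁿ ψ̂(a r_θ⁻¹ ω)~ ψ̂(a r_θ⁻¹ ω) dμ` is finite and equal to the same invertible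
multivector `C` for almost every `ω`. -/
structure IsAdmissible {n : ℕ} (ν : Measure (SO n)) (ψ : E n → Cl n) (C : Cl n) : Prop where
  memLp : MemLp ψ 2 volume
  isUnit : IsUnit C
  integrable : ∀ᵐ ω : E n, Integrable (admissibilityIntegrand ψ ω) (muMeasure ν)
  integral_eq : ∀ᵐ ω : E n, ∫ p, admissibilityIntegrand ψ ω p ∂(muMeasure ν) = C

/-- The grade restriction on the mother wavelet and the sign `ε`: for `n ≡ 2 mod 4`, `ψ` is
even-graded and `ε = 1`, or odd-graded and `ε = -1`; for `n ≡ 3 mod 4`, `ε = 1`. -/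
def HasParity {n : ℕ} (ψ : E n → Cl n) (ε : ℤ) : Prop :=
  (n % 4 = 2 →
    (ε = 1 ∧ ∀ᵐ x : E n, ψ x ∈ CliffordAlgebra.evenOdd (Q n) 0) ∨
    (ε = -1 ∧ ∀ᵐ x : E n, ψ x ∈ CliffordAlgebra.evenOdd (Q n) 1)) ∧
  (n % 4 = 3 → ε = 1)

/-- The Clifford wavelet transform `T_ψ f(a, θ, b) = ∫ f(x) ψ_{a,θ,b}(x)~ dⁿx`. -/
def waveletTransform {n : ℕ} (ψ f : E n → Cl n) (g : SIM n) : Cl n :=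
  l2Inner f (daughter ψ g)

/-- The constant `C'_ψ = εⁿ C_ψ`. -/
def signedConstant {n : ℕ} (ε : ℤ) (C : Cl n) : Cl n := ((ε : ℝ) ^ n) • C

/-- The kernel `K_ψ(g; g') = (ψ_g C'⁻¹, ψ_{g'})`. -/
def kernel {n : ℕ} (ψ : E n → Cl n) (C' : Cl n) (g g' : SIM n) : Cl n :=
  l2Inner (fun x => daughter ψ g x * Ring.inverse C') (daughter ψ g')

end CliffordWavelet

end

open CliffordWavelet

/-! In the frequency domain the transform `b ↦ T_ψ f(a, θ, b)` is, up to a constant, right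
multiplication of `f̂` by the reversion of the dilated `ψ̂`. The values of `ψ̂` commute or
anticommute with `i_n` (for even `n` this uses the parity of `ψ`), so the phases `exp(-i_n ω·b)`
can be moved past them. Plancherel's theorem in `b`, followed by Fubini's theorem and the
admissibility condition, then gives the orthogonality relation
`∫ T_ψ f (T_ψ h)~ dλ = (f C_ψ, h)`, in which `C_ψ` passes through the Fourier transform because it
commutes with `i_n`. Since `K_ψ(·; g')` is the reversion of `T_ψ h` for `h = ψ_{g'} (C_ψ⁻¹)~`,
this relation is the reproducing formula. -/

noncomputable section

namespace CliffordWavelet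

theorem word_cons (n : ℕ) (a : Fin n) (l : List (Fin n)) :
    word n (a :: l) = vec n a * word n l := by simp [word]

theorem word_concat (n : ℕ) (a : Fin n) (l : List (Fin n)) :
    word n (l ++ [a]) = word n l * vec n a := by simp [word]

theorem ι_eq_sum_vec {n : ℕ} (v : E n) :
    CliffordAlgebra.ι (Q n) v = ∑ i, v i • vec n i := by
  conv_lhs => rw [← (EuclideanSpace.basisFun (Fin n) ℝ).sum_repr v]
  simp [vec]

theorem word_mul_vec_of_notMem {n : ℕ} {l : List (Fin n)} {j : Fin n} (hj : j ∉ l) :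
    word n l * vec n j = (-1 : ℝ) ^ l.length • (vec n j * word n l) := by
  induction l with
  | nil => simp [word]
  | cons a t ih =>
    rw [List.mem_cons, not_or] at hj
    rw [word_cons, mul_assoc, ih hj.2, mul_smul_comm, ← mul_assoc, ← mul_assoc,
      vec_mul_vec n (Ne.symm hj.1)]
    simp [pow_succ, neg_mul]

theorem word_mul_vec_of_mem {n : ℕ} {l : List (Fin n)} (hl : l.Nodup) {j : Fin n} (hj : j ∈ l) :
    word n l * vec n j = (-1 : ℝ) ^ (l.length + 1) • (vec n j * word n l) := by
  induction l with
  | nil => simp at hj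
  | cons a t ih =>
    rw [List.nodup_cons] at hl
    rcases eq_or_ne j a with rfl | hja
    · rw [word_cons, mul_assoc, word_mul_vec_of_notMem hl.1, mul_smul_comm]
      simp [pow_succ]
    · have hjt : j ∈ t := by simpa [hja] using hj
      rw [word_cons, mul_assoc, ih hl.2 hjt, mul_smul_comm, ← mul_assoc, ← mul_assoc,
        vec_mul_vec n (Ne.symm hja)]
      simp [pow_succ, neg_mul]

theorem word_reverse {n : ℕ} {l : List (Fin n)} (hl : l.Nodup) :
    word n l.reverse = (-1 : ℝ) ^ l.length.choose 2 • word n l := by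
  induction l with
  | nil => simp [word]
  | cons a t ih =>
    rw [List.nodup_cons] at hl
    rw [List.reverse_cons, word_concat, ih hl.2, smul_mul_assoc, word_mul_vec_of_notMem hl.1,
      smul_smul, word_cons, List.length_cons, Nat.choose_succ_succ' _ 1, Nat.choose_one_right,
      ← pow_add, add_comm]

theorem pseudoscalar_eq_word (n : ℕ) : pseudoscalar n = word n (List.finRange n) := by
  rw [pseudoscalar, word, List.ofFn_eq_map]

theorem odd_choose_two_of_mod_four {n : ℕ} (hn : n % 4 = 2 ∨ n % 4 = 3) : Odd (n.choose 2) := by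
  have hmul : n.choose 2 * 2 = n * (n - 1) := by
    rw [Nat.choose_two_right, Nat.div_mul_cancel (Nat.even_mul_pred_self n).two_dvd]
  obtain ⟨k, rfl | rfl⟩ : ∃ k, n = 4 * k + 2 ∨ n = 4 * k + 3 := ⟨n / 4, by omega⟩
  · exact ⟨4 * k * k + 3 * k, mul_right_cancel₀ two_ne_zero (hmul.trans (by
      rw [show 4 * k + 2 - 1 = 4 * k + 1 by omega]; ring))⟩
  · exact ⟨4 * k * k + 5 * k + 1, mul_right_cancel₀ two_ne_zero (hmul.trans (by
      rw [show 4 * k + 3 - 1 = 4 * k + 2 by omega]; ring))⟩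

theorem reverse_pseudoscalar {n : ℕ} (hn : n % 4 = 2 ∨ n % 4 = 3) :
    CliffordAlgebra.reverse (pseudoscalar n) = -pseudoscalar n := by
  rw [pseudoscalar_eq_word, reverse_word, word_reverse (List.nodup_finRange n),
    List.length_finRange, (odd_choose_two_of_mod_four hn).neg_one_pow, neg_one_smul]

theorem pseudoscalar_mul_self {n : ℕ} (hn : n % 4 = 2 ∨ n % 4 = 3) :
    pseudoscalar n * pseudoscalar n = -1 := by
  have h := word_mul_reverse n (List.finRange n)
  rw [← reverse_word, ← pseudoscalar_eq_word, reverse_pseudoscalar hn, mul_neg] at h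
  exact neg_eq_iff_eq_neg.1 h

theorem pseudoscalar_mul_ι (n : ℕ) (v : E n) :
    pseudoscalar n * CliffordAlgebra.ι (Q n) v =
      (-1 : ℝ) ^ (n + 1) • (CliffordAlgebra.ι (Q n) v * pseudoscalar n) := by
  rw [ι_eq_sum_vec, Finset.mul_sum, Finset.sum_mul, Finset.smul_sum]
  refine Finset.sum_congr rfl fun i _ => ?_
  rw [mul_smul_comm, pseudoscalar_eq_word,
    word_mul_vec_of_mem (List.nodup_finRange n) (List.mem_finRange i), List.length_finRange,
    smul_mul_assoc, smul_comm]

theorem mul_pseudoscalar_of_odd {n : ℕ} (hn : Odd n) (M : Cl n) :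
    M * pseudoscalar n = pseudoscalar n * M := by
  induction M using CliffordAlgebra.induction with
  | algebraMap r => exact Algebra.commutes r _
  | ι v => rw [pseudoscalar_mul_ι, hn.add_one.neg_one_pow, one_smul]
  | mul a b ha hb => rw [mul_assoc, hb, ← mul_assoc, ha, mul_assoc]
  | add a b ha hb => rw [add_mul, mul_add, ha, hb]

theorem mul_pseudoscalar_of_even {n : ℕ} (hn : Even n) (M : Cl n) :
    M * pseudoscalar n = pseudoscalar n * CliffordAlgebra.involute M := by
  induction M using CliffordAlgebra.induction with
  | algebraMap r => rw [AlgHom.commutes, Algebra.commutes]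
  | ι v =>
    rw [CliffordAlgebra.involute_ι, mul_neg, pseudoscalar_mul_ι, hn.add_one.neg_one_pow,
      neg_one_smul, neg_neg]
  | mul a b ha hb => rw [mul_assoc, hb, ← mul_assoc, ha, map_mul, mul_assoc]
  | add a b ha hb => rw [add_mul, map_add, mul_add, ha, hb]

theorem HasParity.exists_ae_mul_pseudoscalar {n : ℕ} (hn : n % 4 = 2 ∨ n % 4 = 3)
    {ψ : E n → Cl n} {ε : ℤ} (hε : HasParity ψ ε) :
    ∃ σ : ℤˣ, ∀ᵐ x, ψ x * pseudoscalar n = σ • (pseudoscalar n * ψ x) := by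
  rcases hn with hn | hn
  · have heven : Even n := Nat.even_iff.2 (by omega)
    rcases hε.1 hn with ⟨-, hψ⟩ | ⟨-, hψ⟩
    · refine ⟨1, hψ.mono fun x hx => ?_⟩
      rw [mul_pseudoscalar_of_even heven, CliffordAlgebra.involute_eq_of_mem_even hx, one_smul]
    · refine ⟨-1, hψ.mono fun x hx => ?_⟩
      rw [mul_pseudoscalar_of_even heven, CliffordAlgebra.involute_eq_of_mem_odd hx, mul_neg,
        Units.neg_smul, one_smul]
  · have hodd : Odd n := Nat.odd_iff.2 (by omega)
    exact ⟨1, Eventually.of_forall fun x => by rw [mul_pseudoscalar_of_odd hodd, one_smul]⟩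

theorem HasParity.signedConstant_eq {n : ℕ} (hn : n % 4 = 2 ∨ n % 4 = 3)
    {ψ : E n → Cl n} {ε : ℤ} (hε : HasParity ψ ε) (C : Cl n) : signedConstant ε C = C := by
  have hpow : (ε : ℝ) ^ n = 1 := by
    rcases hn with hn | hn
    · have heven : Even n := Nat.even_iff.2 (by omega)
      rcases hε.1 hn with ⟨rfl, -⟩ | ⟨rfl, -⟩ <;> simp [heven.neg_one_pow]
    · simp [hε.2 hn]
  rw [signedConstant, hpow, one_smul]

theorem inner_mul_left {n : ℕ} (M N P : Cl n) :
    inner ℝ (M * N) P = inner ℝ M (P * CliffordAlgebra.reverse N) := by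
  change scalarPart n _ = scalarPart n _
  simp only [CliffordAlgebra.reverse.map_mul, CliffordAlgebra.reverse_reverse, mul_assoc]

/-- Multiplication in the Clifford algebra as a continuous bilinear map; the modulus is not
submultiplicative, so this replaces the structure of a normed algebra. -/
def mulL (n : ℕ) : Cl n →L[ℝ] Cl n →L[ℝ] Cl n := (LinearMap.mul ℝ (Cl n)).toContinuousBilinearMap

@[simp] theorem mulL_apply {n : ℕ} (M N : Cl n) : mulL n M N = M * N := rfl

/-- Reversion as a continuous linear equivalence. -/
def reverseL (n : ℕ) : Cl n ≃L[ℝ] Cl n :=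
  (CliffordAlgebra.reverseEquiv (Q := Q n)).toContinuousLinearEquiv

@[simp] theorem reverseL_apply {n : ℕ} (M : Cl n) : reverseL n M = CliffordAlgebra.reverse M := rfl

@[fun_prop]
theorem continuous_reverse (n : ℕ) : Continuous fun M : Cl n => CliffordAlgebra.reverse M :=
  (reverseL n).continuous

instance instContinuousMulCl (n : ℕ) : ContinuousMul (Cl n) :=
  ⟨(mulL n).continuous₂⟩

section ComplexStructure

variable {n : ℕ} [hn : Fact (n % 4 = 2 ∨ n % 4 = 3)]

variable (n) in
/-- The embedding of the complex numbers into the Clifford algebra that sends `I` to `i_n`. -/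
def ofComplex : ℂ →ₐ[ℝ] Cl n := Complex.liftAux (pseudoscalar n) (pseudoscalar_mul_self hn.out)

theorem ofComplex_apply (z : ℂ) :
    ofComplex n z = z.re • (1 : Cl n) + z.im • pseudoscalar n := by
  rw [ofComplex, Complex.liftAux_apply, Algebra.algebraMap_eq_smul_one]

theorem expI_eq_ofComplex (t : ℝ) : expI n t = ofComplex n (Complex.exp (t * Complex.I)) := by
  rw [expI, ofComplex_apply, Complex.exp_ofReal_mul_I_re, Complex.exp_ofReal_mul_I_im]

theorem expI_add (s t : ℝ) : expI n (s + t) = expI n s * expI n t := by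
  simp only [expI_eq_ofComplex, ← map_mul, ← Complex.exp_add, Complex.ofReal_add, add_mul]

theorem reverse_ofComplex (z : ℂ) :
    CliffordAlgebra.reverse (ofComplex n z) = ofComplex n (starRingEnd ℂ z) := by
  simp [ofComplex_apply, reverse_pseudoscalar hn.out]

theorem reverse_expI (t : ℝ) : CliffordAlgebra.reverse (expI n t) = expI n (-t) := by
  simp [expI, reverse_pseudoscalar hn.out]

theorem norm_mul_ofComplex (M : Cl n) (z : ℂ) : ‖M * ofComplex n z‖ = ‖z‖ * ‖M‖ := by
  refine (pow_left_inj₀ (norm_nonneg _) (by positivity) two_ne_zero).1 ?_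
  rw [← real_inner_self_eq_norm_sq, inner_mul_left, reverse_ofComplex, mul_assoc, ← map_mul,
    Complex.mul_conj, ← Complex.coe_algebraMap, AlgHom.commutes, ← Algebra.commutes,
    ← Algebra.smul_def, inner_smul_right, real_inner_self_eq_norm_sq, mul_pow,
    Complex.normSq_eq_norm_sq]

theorem norm_mul_expI (M : Cl n) (t : ℝ) : ‖M * expI n t‖ = ‖M‖ := by
  rw [expI_eq_ofComplex, norm_mul_ofComplex, Complex.norm_exp_ofReal_mul_I, one_mul]

end ComplexStructure

@[fun_prop]
theorem continuous_expI (n : ℕ) : Continuous (expI n) := by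
  unfold expI; fun_prop

theorem mul_expI_of_mul_pseudoscalar {n : ℕ} {M : Cl n} {σ : ℤˣ}
    (hM : M * pseudoscalar n = σ • (pseudoscalar n * M)) (t : ℝ) :
    M * expI n t = expI n (σ • t) * M := by
  rcases Int.units_eq_one_or σ with rfl | rfl <;> simp [expI, mul_add, add_mul, hM]

section LpLemmas

variable {α β G : Type*} [MeasurableSpace α] [MeasurableSpace β] [NormedAddCommGroup G]
  {μ : Measure α} {ν : Measure β}

theorem eLpNorm_two_sq (μ : Measure α) (f : α → G) :
    eLpNorm f 2 μ ^ 2 = ∫⁻ x, ‖f x‖ₑ ^ 2 ∂μ := by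
  simpa using eLpNorm_nnreal_pow_eq_lintegral (μ := μ) (f := f) (p := 2) two_ne_zero

theorem eLpNorm_two_sq_prod [SFinite ν] {F : α × β → G}
    (hF : AEStronglyMeasurable F (μ.prod ν)) :
    eLpNorm F 2 (μ.prod ν) ^ 2 = ∫⁻ x, eLpNorm (fun y => F (x, y)) 2 ν ^ 2 ∂μ := by
  simp_rw [eLpNorm_two_sq]
  exact lintegral_prod _ (hF.enorm.pow_const 2)

theorem memLp_two_of_eLpNorm_sq {f : α → G} (hf : AEStronglyMeasurable f μ)
    (hfin : eLpNorm f 2 μ ^ 2 ≠ ⊤) : MemLp f 2 μ :=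
  ⟨hf, (ENNReal.pow_ne_top_iff.1 hfin).resolve_right two_ne_zero |>.lt_top⟩

theorem ae_memLp_two_prodMk [SFinite ν] {F : α × β → G} (hF : MemLp F 2 (μ.prod ν)) :
    ∀ᵐ x ∂μ, MemLp (fun y => F (x, y)) 2 ν := by
  have hsq : ∫⁻ x, ∫⁻ y, ‖F (x, y)‖ₑ ^ 2 ∂ν ∂μ ≠ ⊤ := by
    simp_rw [← eLpNorm_two_sq]
    rw [← eLpNorm_two_sq_prod hF.1]
    exact (ENNReal.pow_lt_top hF.2).ne
  filter_upwards [hF.1.prodMk_left,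
    ae_lt_top' (hF.1.enorm.pow_const 2).lintegral_prod_right' hsq] with x hmeas hfin
  exact memLp_two_of_eLpNorm_sq hmeas (by rw [eLpNorm_two_sq]; exact hfin.ne)

theorem ae_eq_of_tendsto_eLpNorm_sub {ι : Type*} {l : Filter ι} [l.NeBot] {p : ENNReal}
    (hp : 1 ≤ p) {φ χ : α → G} {w : ι → α → G} (hφ : AEStronglyMeasurable φ μ)
    (hχ : AEStronglyMeasurable χ μ) (hw : ∀ k, AEStronglyMeasurable (w k) μ)
    (hφw : Tendsto (fun k => eLpNorm (φ - w k) p μ) l (𝓝 0))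
    (hχw : Tendsto (fun k => eLpNorm (χ - w k) p μ) l (𝓝 0)) : φ =ᵐ[μ] χ := by
  have hle : eLpNorm (φ - χ) p μ ≤ 0 + 0 := by
    refine ge_of_tendsto (hφw.add hχw) (Eventually.of_forall fun k => ?_)
    rw [← sub_sub_sub_cancel_right φ χ (w k)]
    exact eLpNorm_sub_le (hφ.sub (hw k)) (hχ.sub (hw k)) hp
  have hzero := (eLpNorm_eq_zero_iff (hφ.sub hχ) (one_pos.trans_le hp).ne').1 (by simpa using hle)
  filter_upwards [hzero] with x hx using sub_eq_zero.1 hx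

theorem tendsto_eLpNorm_sub_indicator {ι : Type*} {l : Filter ι} [l.IsCountablyGenerated]
    {s : ι → Set α} (hs : ∀ i, MeasurableSet (s i)) (hsl : ∀ x, ∀ᶠ i in l, x ∈ s i)
    {p : ENNReal} (hp : p ≠ ⊤) {f : α → G} (hf : MemLp f p μ) :
    Tendsto (fun i => eLpNorm (f - (s i).indicator f) p μ) l (𝓝 0) := by
  rcases eq_or_ne p 0 with rfl | hp0
  · simpa using tendsto_const_nhds
  have hpos : 0 < p.toReal := ENNReal.toReal_pos hp0 hp
  have hlim : Tendsto (fun i => ∫⁻ x, ‖(f - (s i).indicator f) x‖ₑ ^ p.toReal ∂μ) l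
      (𝓝 (∫⁻ _, 0 ∂μ)) := by
    refine tendsto_lintegral_filter_of_dominated_convergence' (fun x => ‖f x‖ₑ ^ p.toReal)
      (.of_forall fun i => (hf.1.sub (hf.1.indicator (hs i))).enorm.pow_const _)
      (.of_forall fun i => ae_of_all _ fun x => ?_)
      (lintegral_rpow_enorm_lt_top_of_eLpNorm_lt_top hp0 hp hf.2).ne (ae_of_all _ fun x => ?_)
    · by_cases hx : x ∈ s i <;> simp [hx, ENNReal.zero_rpow_of_pos hpos]
    · refine tendsto_const_nhds.congr' ((hsl x).mono fun i hx => ?_)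
      simp [hx, ENNReal.zero_rpow_of_pos hpos]
  simp_rw [eLpNorm_eq_lintegral_rpow_enorm_toReal hp0 hp]
  simpa [hpos] using hlim.ennrpow_const (1 / p.toReal)

end LpLemmas

section FourierIntegral

open FourierTransform SchwartzMap
open scoped ContDiff

variable {V F : Type*} [NormedAddCommGroup V] [InnerProductSpace ℝ V] [FiniteDimensional ℝ V]
  [MeasurableSpace V] [BorelSpace V] [NormedAddCommGroup F] [InnerProductSpace ℂ F]

theorem continuous_fourier {f : V → F} (hf : Integrable f) : Continuous (𝓕 f) :=
  VectorFourier.fourierIntegral_continuous Real.continuous_fourierChar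
    (by exact continuous_inner) hf

variable [CompleteSpace F]

theorem fourier_ae_eq_fourier_toLp {f : V → F} (hf : Integrable f) (hf2 : MemLp f 2) :
    𝓕 f =ᵐ[volume] (𝓕 (hf2.toLp f) : Lp F 2 (volume : Measure V)) := by
  set Φ : Lp F 2 (volume : Measure V) := 𝓕 (hf2.toLp f)
  apply ae_eq_of_integral_contDiff_smul_eq (continuous_fourier hf).locallyIntegrable
    ((Lp.memLp _).locallyIntegrable (by norm_num))
  intro g g_smooth g_cpt
  have hcpt : HasCompactSupport (Complex.ofRealCLM ∘ g) := g_cpt.comp_left rfl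
  let s : 𝓢(V, ℂ) := hcpt.toSchwartzMap (by fun_prop : ContDiff ℝ ∞ (Complex.ofRealCLM ∘ g))
  have smul_eq (x : V) (y : F) : g x • y = s x • y := (Complex.coe_smul (g x) y).symm
  simp_rw [smul_eq]
  symm
  calc ∫ x, s x • Φ x
      = ∫ x, 𝓕 (s : V → ℂ) x • (hf2.toLp f) x := by
        have := DFunLike.congr_fun (Lp.fourier_toTemperedDistribution_eq (hf2.toLp f)) s
        rw [TemperedDistribution.fourier_apply, Lp.toTemperedDistribution_apply,
          Lp.toTemperedDistribution_apply] at this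
        rw [← SchwartzMap.fourier_coe]
        exact this.symm
    _ = ∫ x, 𝓕 (s : V → ℂ) x • f x := by
        refine integral_congr_ae ?_
        filter_upwards [hf2.coeFn_toLp] with x hx
        rw [hx]
    _ = ∫ x, s x • 𝓕 f x := by
        have := VectorFourier.integral_fourierIntegral_smul_eq_flip (μ := (volume : Measure V))
          (ν := (volume : Measure V)) (L := innerₗ V) (f := (s : V → ℂ)) (g := f)
          Real.continuous_fourierChar (by exact continuous_inner) s.integrable hf
        rwa [flip_innerₗ] at this

theorem eLpNorm_fourier_toLp_sub {f u : V → F} (hf : MemLp f 2) (hu : Integrable u)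
    (hu2 : MemLp u 2) :
    eLpNorm (⇑(𝓕 (hf.toLp f) : Lp F 2 (volume : Measure V)) - 𝓕 u) 2 volume =
      eLpNorm (f - u) 2 volume := by
  have hsub : (𝓕 ((hf.sub hu2).toLp (f - u)) : Lp F 2 (volume : Measure V)) =
      𝓕 (hf.toLp f) - 𝓕 (hu2.toLp u) := by
    rw [MemLp.toLp_sub hf hu2]
    exact (Lp.fourierTransformₗᵢ V F).map_sub _ _
  have hae : ⇑(𝓕 (hf.toLp f) : Lp F 2 (volume : Measure V)) - 𝓕 u =ᵐ[volume]
      (𝓕 ((hf.sub hu2).toLp (f - u)) : Lp F 2 (volume : Measure V)) := by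
    rw [hsub]
    exact ((EventuallyEq.refl _ _).sub (fourier_ae_eq_fourier_toLp hu hu2)).trans
      (Lp.coeFn_sub _ _).symm
  rw [eLpNorm_congr_ae hae, ← eLpNorm_congr_ae (hf.sub hu2).coeFn_toLp, ← Lp.enorm_def,
    ← Lp.enorm_def, ← ofReal_norm, ← ofReal_norm, Lp.norm_fourier_eq]

end FourierIntegral

section Similitudes

variable {n : ℕ}

theorem isClosed_specialOrthogonalGroup (n : ℕ) :
    IsClosed (Matrix.specialOrthogonalGroup (Fin n) ℝ : Set (Matrix (Fin n) (Fin n) ℝ)) := by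
  have heq : (Matrix.specialOrthogonalGroup (Fin n) ℝ : Set (Matrix (Fin n) (Fin n) ℝ)) =
      {A | A * A.transpose = 1} ∩ {A | A.det = 1} := by
    ext A
    rw [SetLike.mem_coe, Matrix.mem_specialOrthogonalGroup_iff, Matrix.mem_orthogonalGroup_iff]
    rfl
  rw [heq]
  exact (isClosed_eq (by fun_prop) (by fun_prop)).inter (isClosed_eq (by fun_prop) (by fun_prop))

instance instSigmaCompactSpaceSO (n : ℕ) : SigmaCompactSpace (SO n) :=
  have : SigmaCompactSpace (Matrix (Fin n) (Fin n) ℝ) :=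
    inferInstanceAs (SigmaCompactSpace (Fin n → Fin n → ℝ))
  (isClosed_specialOrthogonalGroup n).sigmaCompactSpace

instance instSecondCountableTopologySO (n : ℕ) : SecondCountableTopology (SO n) :=
  have : SecondCountableTopology (Matrix (Fin n) (Fin n) ℝ) :=
    inferInstanceAs (SecondCountableTopology (Fin n → Fin n → ℝ))
  inferInstanceAs (SecondCountableTopology
    (Matrix.specialOrthogonalGroup (Fin n) ℝ : Set (Matrix (Fin n) (Fin n) ℝ)))

instance instSFiniteScaleMeasure (n : ℕ) : SFinite (scaleMeasure n) := by
  have : SigmaFinite ((volume : Measure ℝ).comap (Subtype.val : Set.Ioi (0 : ℝ) → ℝ)) := by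
    refine SigmaFinite.of_map _ measurable_subtype_coe.aemeasurable ?_
    rw [map_comap_subtype_coe measurableSet_Ioi]
    infer_instance
  unfold scaleMeasure
  infer_instance

instance instSFiniteMuMeasure (ν : Measure (SO n)) [SFinite ν] : SFinite (muMeasure ν) := by
  unfold muMeasure
  infer_instance

theorem rotate_mul (r s : SO n) (x : E n) : rotate (r * s) x = rotate r (rotate s x) := by
  simp [rotate, Matrix.mulVec_mulVec]

theorem rotate_one (x : E n) : rotate 1 x = x := by
  simp [rotate]

theorem inner_rotate (r : SO n) (x y : E n) :
    inner ℝ (rotate r x) (rotate r y) = inner ℝ x y := by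
  simp only [rotate, EuclideanSpace.inner_eq_star_dotProduct, star_trivial]
  rw [Matrix.dotProduct_mulVec, ← Matrix.mulVec_transpose, Matrix.mulVec_mulVec,
    (Matrix.mem_orthogonalGroup_iff' _ _).1 r.2.1, Matrix.one_mulVec]

/-- Rotations as linear isometric equivalences. -/
def rotateEquiv (r : SO n) : E n ≃ₗᵢ[ℝ] E n :=
  LinearEquiv.isometryOfInner
    { toFun := rotate r
      invFun := rotate r⁻¹
      map_add' x y := by simp [rotate, Matrix.mulVec_add]
      map_smul' c x := by simp [rotate, Matrix.mulVec_smul]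
      left_inv x := by rw [← rotate_mul, inv_mul_cancel, rotate_one]
      right_inv x := by rw [← rotate_mul, mul_inv_cancel, rotate_one] }
    (inner_rotate r)

theorem inner_rotate_right (r : SO n) (x y : E n) :
    inner ℝ x (rotate r y) = inner ℝ (rotate r⁻¹ x) y :=
  ((rotateEquiv r).symm.inner_map_eq_flip x y).symm

theorem continuous_rotate_inv : Continuous fun q : SO n × E n => rotate q.1⁻¹ q.2 :=
  (PiLp.continuous_toLp 2 _).comp <| Continuous.matrix_mulVec
    (A := fun q : SO n × E n => q.1.1.transpose) (by fun_prop) (by fun_prop)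

/-- The similitude `x ↦ a r x + b` that `((a, r), b)` stands for. -/
def similitude (g : SIM n) : E n ≃ₜ E n :=
  ((rotateEquiv g.1.2).toHomeomorph.trans
    (Homeomorph.smulOfNeZero (g.1.1 : ℝ) g.1.1.2.out.ne')).trans (Homeomorph.subRight g.2).symm

theorem similitude_apply (g : SIM n) (x : E n) :
    similitude g x = (g.1.1 : ℝ) • rotate g.1.2 x + g.2 := rfl

theorem daughter_apply (ψ : E n → Cl n) (g : SIM n) (x : E n) :
    daughter ψ g x = ((g.1.1 : ℝ) ^ (-(n : ℝ) / 2)) • ψ ((similitude g).symm x) := rfl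

theorem map_similitude_symm (g : SIM n) :
    (volume : Measure (E n)).map (similitude g).symm =
      ENNReal.ofReal ((g.1.1 : ℝ) ^ n) • volume := by
  have hscale : (volume : Measure (E n)).map
      (Homeomorph.smulOfNeZero (g.1.1 : ℝ) g.1.1.2.out.ne').symm =
        ENNReal.ofReal ((g.1.1 : ℝ) ^ n) • volume := by
    refine (Measure.map_addHaar_smul _ (inv_ne_zero g.1.1.2.out.ne')).trans ?_
    rw [finrank_euclideanSpace_fin, inv_pow, inv_inv, abs_of_pos (pow_pos g.1.1.2 n)]
  have hcomp : ⇑(similitude g).symm = (rotateEquiv g.1.2).symm ∘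
      (Homeomorph.smulOfNeZero (g.1.1 : ℝ) g.1.1.2.out.ne').symm ∘ (Homeomorph.subRight g.2) := rfl
  rw [hcomp, ← Measure.map_map (rotateEquiv g.1.2).symm.continuous.measurable
      ((Homeomorph.measurable _).comp (Homeomorph.measurable _)),
    ← Measure.map_map (Homeomorph.measurable _) (Homeomorph.measurable _),
    Homeomorph.coe_subRight, (measurePreserving_sub_right volume g.2).map_eq, hscale,
    Measure.map_smul, (rotateEquiv g.1.2).symm.measurePreserving.map_eq]

theorem quasiMeasurePreserving_similitude_symm (g : SIM n) :
    Measure.QuasiMeasurePreserving (similitude g).symm (volume : Measure (E n)) volume :=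
  ⟨(similitude g).symm.measurable, by
    rw [map_similitude_symm]; exact Measure.smul_absolutelyContinuous⟩

theorem continuous_uncurry_similitude_symm :
    Continuous fun q : SIM n × E n => (similitude q.1).symm q.2 := by
  change Continuous fun q : SIM n × E n => rotate q.1.1.2⁻¹ ((q.1.1.1 : ℝ)⁻¹ • (q.2 - q.1.2))
  have hinv : Continuous fun q : SIM n × E n => (q.1.1.1 : ℝ)⁻¹ :=
    Continuous.inv₀ (by fun_prop) fun q => q.1.1.1.2.out.ne'
  have hsub : Continuous fun q : SIM n × E n => q.2 - q.1.2 := by fun_prop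
  have hrot : Continuous fun q : SIM n × E n => q.1.1.2 := by fun_prop
  exact continuous_rotate_inv.comp (hrot.prodMk (hinv.smul hsub))

theorem quasiMeasurePreserving_uncurry_similitude_symm {α : Type*} [MeasurableSpace α]
    (μ : Measure α) {γ : α → SIM n} (hγ : Measurable γ) :
    Measure.QuasiMeasurePreserving (fun q : α × E n => (similitude (γ q.1)).symm q.2)
      (μ.prod volume) volume := by
  have hpair : Measurable fun q : α × E n => (γ q.1, q.2) := by fun_prop
  have hmeas := continuous_uncurry_similitude_symm.measurable.comp hpair
  exact QuasiMeasurePreserving.prod_of_right hmeas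
    (ae_of_all _ fun x => quasiMeasurePreserving_similitude_symm (γ x))

end Similitudes

section Daughter

variable {n : ℕ}

theorem rpow_neg_half_sq_mul_pow {a : ℝ} (ha : 0 < a) (n : ℕ) :
    (a ^ (-(n : ℝ) / 2)) ^ 2 * a ^ n = 1 := by
  rw [← Real.rpow_natCast, ← Real.rpow_mul ha.le, ← Real.rpow_natCast a n, ← Real.rpow_add ha]
  simp

theorem aestronglyMeasurable_daughter {ψ : E n → Cl n} (hψ : AEStronglyMeasurable ψ volume)
    (g : SIM n) : AEStronglyMeasurable (daughter ψ g) volume := by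
  exact (hψ.comp_quasiMeasurePreserving
    (quasiMeasurePreserving_similitude_symm g)).const_smul ((g.1.1 : ℝ) ^ (-(n : ℝ) / 2))

theorem aestronglyMeasurable_uncurry_daughter {α : Type*} [MeasurableSpace α] {ψ : E n → Cl n}
    (hψ : AEStronglyMeasurable ψ volume) (μ : Measure α) {γ : α → SIM n} (hγ : Measurable γ) :
    AEStronglyMeasurable (fun q : α × E n => daughter ψ (γ q.1) q.2) (μ.prod volume) := by
  have hscale : Measurable fun q : α × E n => ((γ q.1).1.1 : ℝ) ^ (-(n : ℝ) / 2) := by fun_prop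
  exact hscale.aestronglyMeasurable.smul (hψ.comp_quasiMeasurePreserving
    (quasiMeasurePreserving_uncurry_similitude_symm μ hγ))

theorem eLpNorm_daughter (ψ : E n → Cl n) (g : SIM n) :
    eLpNorm (daughter ψ g) 2 volume = eLpNorm ψ 2 volume := by
  have hscale : 0 ≤ (g.1.1 : ℝ) ^ (-(n : ℝ) / 2) := Real.rpow_nonneg g.1.1.2.out.le _
  have hmap := (similitude g).symm.measurableEmbedding.lintegral_map
    (μ := (volume : Measure (E n))) fun x => ‖ψ x‖ₑ ^ 2
  rw [map_similitude_symm, lintegral_smul_measure] at hmap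
  refine (ENNReal.pow_right_strictMono two_ne_zero).injective ?_
  simp only [eLpNorm_two_sq, daughter_apply, enorm_smul, mul_pow]
  rw [lintegral_const_mul' _ _ (by simp), ← hmap, smul_eq_mul, ← mul_assoc,
    Real.enorm_of_nonneg hscale, ← ENNReal.ofReal_pow hscale, ← ENNReal.ofReal_mul (by positivity),
    rpow_neg_half_sq_mul_pow g.1.1.2, ENNReal.ofReal_one, one_mul]

theorem memLp_daughter {ψ : E n → Cl n} (hψ : MemLp ψ 2 volume) (g : SIM n) :
    MemLp (daughter ψ g) 2 volume :=
  ⟨aestronglyMeasurable_daughter hψ.1 g, (eLpNorm_daughter ψ g).trans_lt hψ.2⟩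

theorem integrable_daughter {ψ : E n → Cl n} (hψ : Integrable ψ) (g : SIM n) :
    Integrable (daughter ψ g) := by
  refine Integrable.smul ((g.1.1 : ℝ) ^ (-(n : ℝ) / 2))
    ((similitude g).symm.measurableEmbedding.integrable_map_iff.1 ?_)
  rw [map_similitude_symm]
  exact hψ.smul_measure ENNReal.ofReal_ne_top

theorem integral_comp_similitude_symm {G : Type*} [NormedAddCommGroup G] [NormedSpace ℝ G]
    (u : E n → G) (g : SIM n) :
    ∫ x, u ((similitude g).symm x) = (g.1.1 : ℝ) ^ n • ∫ x, u x := by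
  rw [← (similitude g).symm.measurableEmbedding.integral_map, map_similitude_symm,
    integral_smul_measure, ENNReal.toReal_ofReal (pow_nonneg g.1.1.2.out.le n)]

theorem integral_bilin_daughter {G : Type*} [NormedAddCommGroup G] [NormedSpace ℝ G]
    (B : Cl n →L[ℝ] Cl n →L[ℝ] G) (φ χ : E n → Cl n) (g : SIM n) :
    ∫ x, B (daughter φ g x) (daughter χ g x) = ∫ x, B (φ x) (χ x) := by
  simp only [daughter_apply, map_smul, smul_apply, smul_smul]
  rw [integral_smul, integral_comp_similitude_symm (fun x => B (φ x) (χ x)), smul_smul, ← sq,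
    rpow_neg_half_sq_mul_pow g.1.1.2, one_smul]

/-- The similitude `x ↦ a⁻¹ r x` dual to `p = (a, r)`: the Fourier transform of a daughter wavelet
of `p` is, up to a phase, the daughter of the Fourier transform for `dualDilation p`. -/
def dualDilation (p : DilRot n) : SIM n := ((⟨(p.1 : ℝ)⁻¹, inv_pos.2 p.1.2.out⟩, p.2), 0)

theorem measurable_dualDilation : Measurable (dualDilation (n := n)) := by
  unfold dualDilation
  fun_prop

theorem similitude_symm_dualDilation (p : DilRot n) (ω : E n) :
    (similitude (dualDilation p)).symm ω = (p.1 : ℝ) • rotate p.2⁻¹ ω := by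
  change rotate p.2⁻¹ ((p.1 : ℝ)⁻¹⁻¹ • (ω - 0)) = _
  rw [inv_inv, sub_zero]
  exact (rotateEquiv p.2⁻¹).map_smul _ _

theorem daughter_dualDilation (φ : E n → Cl n) (p : DilRot n) (ω : E n) :
    daughter φ (dualDilation p) ω =
      (p.1 : ℝ) ^ ((n : ℝ) / 2) • φ ((p.1 : ℝ) • rotate p.2⁻¹ ω) := by
  rw [daughter_apply, similitude_symm_dualDilation, dualDilation, Real.inv_rpow p.1.2.out.le,
    ← Real.rpow_neg p.1.2.out.le, neg_div, neg_neg]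

end Daughter

section ComplexCl

open FourierTransform

/-- The Clifford algebra as a complex inner product space on which `I` acts as right multiplication
by the pseudoscalar; the Clifford Fourier transform is the Fourier transform with values in it. -/
def ComplexCl (n : ℕ) : Type := Cl n

namespace ComplexCl

variable {n : ℕ}

instance : NormedAddCommGroup (ComplexCl n) := inferInstanceAs (NormedAddCommGroup (Cl n))

instance : CompleteSpace (ComplexCl n) := FiniteDimensional.complete ℝ (Cl n)

variable [hn : Fact (n % 4 = 2 ∨ n % 4 = 3)]

instance : Module ℂ (ComplexCl n) :=
  Module.compHom (Cl n) ((ofComplex n : ℂ →+* Cl n).toOpposite fun z w =>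
    (Commute.all z w).map (ofComplex n))

instance : NormedSpace ℂ (ComplexCl n) where
  norm_smul_le z M := (norm_mul_ofComplex (show Cl n from M) z).le

instance : InnerProductSpace ℂ (ComplexCl n) :=
  InnerProductSpace.ofNorm ℂ fun x y => by
    simpa only [pow_two] using! parallelogram_law_with_norm ℝ (show Cl n from x) y

variable (n) in
/-- The identity map, as a real-linear isometric equivalence. -/
def equiv : Cl n ≃ₗᵢ[ℝ] ComplexCl n where
  toFun M := M
  invFun M := M
  map_add' _ _ := rfl
  map_smul' r M := by
    have hsmul : r • M = M * ofComplex n (r : ℂ) := by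
      rw [ofComplex_apply]; simp
    exact hsmul
  left_inv _ := rfl
  right_inv _ := rfl
  norm_map' _ := rfl

theorem equiv_mul_ofComplex (M : Cl n) (z : ℂ) : equiv n (M * ofComplex n z) = z • equiv n M := rfl

theorem re_inner_eq (M N : ComplexCl n) :
    (inner ℂ M N).re = inner ℝ ((equiv n).symm M) ((equiv n).symm N) := by
  rw [real_inner_eq_norm_add_mul_self_sub_norm_mul_self_sub_norm_mul_self_div_two,
    ← map_add, LinearIsometryEquiv.norm_map, LinearIsometryEquiv.norm_map,
    LinearIsometryEquiv.norm_map]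
  exact re_inner_eq_norm_add_mul_self_sub_norm_mul_self_sub_norm_mul_self_div_two (𝕜 := ℂ) M N

theorem equiv_cftIntegral (f : E n → Cl n) (ω : E n) :
    equiv n (cftIntegral f ω) = 𝓕 (fun x => equiv n (f x)) ((2 * Real.pi)⁻¹ • ω) := by
  rw [Real.fourier_eq', cftIntegral]
  refine ((equiv n).toContinuousLinearEquiv.integral_comp_comm
    fun x => f x * expI n (-(inner ℝ ω x))).symm.trans ?_
  congr 1
  ext x
  change equiv n _ = _
  rw [expI_eq_ofComplex, equiv_mul_ofComplex, inner_smul_right, real_inner_comm]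
  congr 4
  field_simp

end ComplexCl

variable {n : ℕ}

/-- The factor `(2π)^{n/2}` by which the Clifford Fourier transform scales the `L²` norm. -/
def plancherelConst (n : ℕ) : ℝ := (2 * Real.pi) ^ ((n : ℝ) / 2)

theorem plancherelConst_sq (n : ℕ) : plancherelConst n ^ 2 = (2 * Real.pi) ^ n := by
  rw [plancherelConst, ← Real.rpow_natCast, ← Real.rpow_mul (by positivity), ← Real.rpow_natCast]
  congr 1
  push_cast
  ring

/-- The dilation by `(2π)⁻¹` that passes from frequency to angular frequency. -/
def angularDilation (n : ℕ) : DilRot n := (⟨(2 * Real.pi)⁻¹, inv_pos.2 Real.two_pi_pos⟩, 1)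

theorem plancherelConst_smul_daughter (φ : E n → Cl n) (ω : E n) :
    plancherelConst n • daughter φ (dualDilation (angularDilation n)) ω =
      φ ((2 * Real.pi)⁻¹ • ω) := by
  rw [daughter_dualDilation, smul_smul, angularDilation, inv_one, rotate_one, plancherelConst,
    ← Real.mul_rpow (by positivity) (by positivity), mul_inv_cancel₀ (by positivity),
    Real.one_rpow, one_smul]

variable [hn : Fact (n % 4 = 2 ∨ n % 4 = 3)]

theorem memLp_equiv_comp {f : E n → Cl n} (hf : MemLp f 2 volume) :
    MemLp (fun x => ComplexCl.equiv n (f x)) 2 volume :=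
  (ComplexCl.equiv n).toContinuousLinearEquiv.toContinuousLinearMap.comp_memLp' hf

/-- The Fourier transform of an `L²` function, in the normalization of unitary frequency and with
values in the Clifford algebra. -/
def fourierL2 {f : E n → Cl n} (hf : MemLp f 2 volume) (ξ : E n) : Cl n :=
  (ComplexCl.equiv n).symm
    ((𝓕 ((memLp_equiv_comp hf).toLp _) : Lp (ComplexCl n) 2 (volume : Measure (E n))) ξ)

theorem memLp_fourierL2 {f : E n → Cl n} (hf : MemLp f 2 volume) : MemLp (fourierL2 hf) 2 volume :=
  (ComplexCl.equiv n).symm.toContinuousLinearEquiv.toContinuousLinearMap.comp_memLp' (Lp.memLp _)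

theorem integral_inner_fourierL2 {f g : E n → Cl n} (hf : MemLp f 2 volume)
    (hg : MemLp g 2 volume) :
    ∫ ξ, inner ℝ (fourierL2 hf ξ) (fourierL2 hg ξ) = ∫ x, inner ℝ (f x) (g x) := by
  have hre (F G : Lp (ComplexCl n) 2 (volume : Measure (E n))) : (inner ℂ F G).re =
      ∫ x, inner ℝ ((ComplexCl.equiv n).symm (F x)) ((ComplexCl.equiv n).symm (G x)) := by
    simp only [← ComplexCl.re_inner_eq]
    exact (integral_re (L2.integrable_inner (𝕜 := ℂ) F G)).symm
  refine (hre _ _).symm.trans ?_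
  rw [Lp.inner_fourier_eq, hre]
  refine integral_congr_ae ?_
  filter_upwards [(memLp_equiv_comp hf).coeFn_toLp, (memLp_equiv_comp hg).coeFn_toLp] with x hfx hgx
  rw [hfx, hgx, LinearIsometryEquiv.symm_apply_apply, LinearIsometryEquiv.symm_apply_apply]

/-- An explicit representative of the Clifford Fourier transform of an `L²` function. -/
def cftRep {f : E n → Cl n} (hf : MemLp f 2 volume) (ω : E n) : Cl n :=
  plancherelConst n • daughter (fourierL2 hf) (dualDilation (angularDilation n)) ω

theorem memLp_cftRep {f : E n → Cl n} (hf : MemLp f 2 volume) : MemLp (cftRep hf) 2 volume :=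
  (memLp_daughter (memLp_fourierL2 hf) _).const_smul (plancherelConst n)

theorem eLpNorm_cftRep_sub_cftIntegral {f u : E n → Cl n} (hf : MemLp f 2 volume)
    (hu : Integrable u) (hu2 : MemLp u 2 volume) :
    eLpNorm (cftRep hf - cftIntegral u) 2 volume =
      ‖plancherelConst n‖ₑ * eLpNorm (f - u) 2 volume := by
  have hdiff : cftRep hf - cftIntegral u = plancherelConst n • daughter
      (fun ξ => fourierL2 hf ξ - (ComplexCl.equiv n).symm (𝓕 (fun x => ComplexCl.equiv n (u x)) ξ))
      (dualDilation (angularDilation n)) := by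
    ext ω
    rw [Pi.smul_apply, plancherelConst_smul_daughter, Pi.sub_apply, cftRep,
      plancherelConst_smul_daughter, ← ComplexCl.equiv_cftIntegral,
      LinearIsometryEquiv.symm_apply_apply]
  have hfourier := eLpNorm_fourier_toLp_sub (memLp_equiv_comp hf)
    ((ComplexCl.equiv n).toContinuousLinearEquiv.toContinuousLinearMap.integrable_comp hu)
    (memLp_equiv_comp hu2)
  have hiso (φ χ : E n → ComplexCl n) :
      eLpNorm (fun ξ => (ComplexCl.equiv n).symm (φ ξ) - (ComplexCl.equiv n).symm (χ ξ)) 2 volume =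
        eLpNorm (φ - χ) 2 volume :=
    eLpNorm_congr_norm_ae (ae_of_all _ fun ξ => by
      rw [← map_sub, LinearIsometryEquiv.norm_map, Pi.sub_apply])
  rw [hdiff, eLpNorm_const_smul, eLpNorm_daughter]
  refine congrArg _ ((hiso _ _).trans (hfourier.trans ?_))
  rw [← hiso]
  simp only [LinearIsometryEquiv.symm_apply_apply]
  rfl

end ComplexCl

section CliffordFourier

variable {n : ℕ}

/-- The truncation of `f` to the ball of radius `R`. -/
def truncate (f : E n → Cl n) (R : ℝ) : E n → Cl n := (Metric.closedBall (0 : E n) R).indicator f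

theorem memLp_truncate {f : E n → Cl n} (hf : MemLp f 2 volume) (R : ℝ) :
    MemLp (truncate f R) 2 volume :=
  hf.indicator measurableSet_closedBall

theorem integrable_truncate {f : E n → Cl n} (hf : MemLp f 2 volume) (R : ℝ) :
    Integrable (truncate f R) := by
  rw [truncate, integrable_indicator_iff measurableSet_closedBall]
  have : IsFiniteMeasure (volume.restrict (Metric.closedBall (0 : E n) R)) :=
    ⟨by simpa using measure_closedBall_lt_top⟩
  exact (hf.restrict _).integrable one_le_two

theorem tendsto_eLpNorm_sub_truncate {f : E n → Cl n} (hf : MemLp f 2 volume) :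
    Tendsto (fun R : ℝ => eLpNorm (f - truncate f R) 2 volume) atTop (𝓝 0) :=
  tendsto_eLpNorm_sub_indicator (fun _ => measurableSet_closedBall)
    (fun x => (eventually_ge_atTop ‖x‖).mono fun _ hR => mem_closedBall_zero_iff.2 hR)
    ENNReal.ofNat_ne_top hf

theorem integrable_mul_reverse {α : Type*} [MeasurableSpace α] {μ : Measure α} {f g : α → Cl n}
    (hf : MemLp f 2 μ) (hg : MemLp g 2 μ) :
    Integrable (fun x => f x * CliffordAlgebra.reverse (g x)) μ :=
  memLp_one_iff_integrable.1 ((mulL n).memLp_of_bilin 1 hf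
    ((reverseL n).toContinuousLinearMap.comp_memLp' hg))

theorem tendsto_eLpNorm_clm_comp {α ι G H : Type*} [MeasurableSpace α] {μ : Measure α}
    [NormedAddCommGroup G] [NormedSpace ℝ G] [NormedAddCommGroup H] [NormedSpace ℝ H]
    {l : Filter ι} {p : ENNReal} (A : G →L[ℝ] H) {w : ι → α → G}
    (hw : Tendsto (fun k => eLpNorm (w k) p μ) l (𝓝 0)) :
    Tendsto (fun k => eLpNorm (fun x => A (w k x)) p μ) l (𝓝 0) := by
  have hbound := ENNReal.Tendsto.const_mul (a := ENNReal.ofReal ‖A‖) hw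
    (Or.inr ENNReal.ofReal_ne_top)
  rw [mul_zero] at hbound
  exact tendsto_of_tendsto_of_tendsto_of_le_of_le tendsto_const_nhds hbound (fun _ => bot_le)
    fun k => eLpNorm_le_mul_eLpNorm_of_ae_le_mul (ae_of_all _ fun x => A.le_opNorm _) p

variable [hn : Fact (n % 4 = 2 ∨ n % 4 = 3)]

theorem integrable_mul_expI {α : Type*} [MeasurableSpace α] {μ : Measure α} {u : α → Cl n}
    (hu : Integrable u μ) {t : α → ℝ} (ht : AEStronglyMeasurable t μ) :
    Integrable (fun x => u x * expI n (t x)) μ :=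
  hu.mono (hu.1.mul ((continuous_expI n).comp_aestronglyMeasurable ht))
    (ae_of_all _ fun _ => (norm_mul_expI _ _).le)

theorem continuous_cftIntegral {u : E n → Cl n} (hu : Integrable u) :
    Continuous (cftIntegral u) := by
  refine continuous_of_dominated (bound := fun x => ‖u x‖) (fun ω => ?_)
    (fun ω => ae_of_all _ fun x => (norm_mul_expI _ _).le) hu.norm
    (ae_of_all _ fun x => by fun_prop)
  exact (integrable_mul_expI hu (Continuous.aestronglyMeasurable (by fun_prop))).1

theorem isCFT_cftRep {f : E n → Cl n} (hf : MemLp f 2 volume) : IsCFT f (cftRep hf) := by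
  have hlim : Tendsto (fun R => ‖plancherelConst n‖ₑ * eLpNorm (f - truncate f R) 2 volume)
      atTop (𝓝 0) := by
    simpa using ENNReal.Tendsto.const_mul (tendsto_eLpNorm_sub_truncate hf) (Or.inr enorm_ne_top)
  exact ⟨memLp_cftRep hf, hlim.congr fun R =>
    (eLpNorm_cftRep_sub_cftIntegral hf (integrable_truncate hf R) (memLp_truncate hf R)).symm⟩

theorem cft_ae_eq_cftRep {f : E n → Cl n} (hf : MemLp f 2 volume) :
    cft f =ᵐ[volume] cftRep hf := by
  have hex : ∃ φ, IsCFT f φ := ⟨_, isCFT_cftRep hf⟩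
  have hcft : IsCFT f (cft f) := by rw [cft, dif_pos hex]; exact hex.choose_spec
  exact ae_eq_of_tendsto_eLpNorm_sub one_le_two hcft.1.1 (memLp_cftRep hf).1
    (fun R => (continuous_cftIntegral (integrable_truncate hf R)).aestronglyMeasurable)
    hcft.2 (isCFT_cftRep hf).2

theorem memLp_cft {f : E n → Cl n} (hf : MemLp f 2 volume) : MemLp (cft f) 2 volume :=
  (memLp_congr_ae (cft_ae_eq_cftRep hf)).2 (memLp_cftRep hf)

theorem eLpNorm_cft_sub_cftIntegral {f u : E n → Cl n} (hf : MemLp f 2 volume)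
    (hu : Integrable u) (hu2 : MemLp u 2 volume) :
    eLpNorm (cft f - cftIntegral u) 2 volume =
      ‖plancherelConst n‖ₑ * eLpNorm (f - u) 2 volume :=
  (eLpNorm_congr_ae ((cft_ae_eq_cftRep hf).sub EventuallyEq.rfl)).trans
    (eLpNorm_cftRep_sub_cftIntegral hf hu hu2)

theorem eLpNorm_cft {f : E n → Cl n} (hf : MemLp f 2 volume) :
    eLpNorm (cft f) 2 volume = ‖plancherelConst n‖ₑ * eLpNorm f 2 volume := by
  have hzero : cftIntegral (fun _ : E n => (0 : Cl n)) = fun _ => 0 := by ext; simp [cftIntegral]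
  simpa [hzero, Pi.sub_def] using
    eLpNorm_cft_sub_cftIntegral hf (u := fun _ => 0) (integrable_zero _ _ _) MemLp.zero'

theorem tendsto_eLpNorm_cft_sub_cftIntegral {ι : Type*} {l : Filter ι} {f : E n → Cl n}
    (hf : MemLp f 2 volume) {u : ι → E n → Cl n} (hu : ∀ k, Integrable (u k))
    (hu2 : ∀ k, MemLp (u k) 2 volume)
    (hlim : Tendsto (fun k => eLpNorm (f - u k) 2 volume) l (𝓝 0)) :
    Tendsto (fun k => eLpNorm (cft f - cftIntegral (u k)) 2 volume) l (𝓝 0) := by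
  simp_rw [eLpNorm_cft_sub_cftIntegral hf (hu _) (hu2 _)]
  simpa using ENNReal.Tendsto.const_mul hlim (Or.inr enorm_ne_top)

theorem tendsto_eLpNorm_cft_sub_truncate {f : E n → Cl n} (hf : MemLp f 2 volume) :
    Tendsto (fun R => eLpNorm (cft f - cftIntegral (truncate f R)) 2 volume) atTop (𝓝 0) :=
  tendsto_eLpNorm_cft_sub_cftIntegral hf (integrable_truncate hf) (memLp_truncate hf)
    (tendsto_eLpNorm_sub_truncate hf)

theorem cft_ae_eq_of_tendsto {ι : Type*} {l : Filter ι} [l.NeBot] {f φ : E n → Cl n}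
    (hf : MemLp f 2 volume) (hφ : AEStronglyMeasurable φ volume) {u : ι → E n → Cl n}
    (hu : ∀ k, Integrable (u k)) (hu2 : ∀ k, MemLp (u k) 2 volume)
    (hlim : Tendsto (fun k => eLpNorm (f - u k) 2 volume) l (𝓝 0))
    (hlim' : Tendsto (fun k => eLpNorm (φ - cftIntegral (u k)) 2 volume) l (𝓝 0)) :
    cft f =ᵐ[volume] φ :=
  ae_eq_of_tendsto_eLpNorm_sub one_le_two (memLp_cft hf).1 hφ
    (fun k => (continuous_cftIntegral (hu k)).aestronglyMeasurable)
    (tendsto_eLpNorm_cft_sub_cftIntegral hf hu hu2 hlim) hlim'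

theorem cft_ae_eq_cftIntegral {f : E n → Cl n} (hf : Integrable f) (hf2 : MemLp f 2 volume) :
    cft f =ᵐ[volume] cftIntegral f :=
  cft_ae_eq_of_tendsto (l := (atTop : Filter ℕ)) (u := fun _ => f) hf2
    (continuous_cftIntegral hf).aestronglyMeasurable (fun _ => hf) (fun _ => hf2)
    (by simp) (by simp)

theorem cft_congr_ae {f g : E n → Cl n} (hf : MemLp f 2 volume) (hfg : f =ᵐ[volume] g) :
    cft f =ᵐ[volume] cft g := by
  have hg : MemLp g 2 volume := (memLp_congr_ae hfg).1 hf
  refine cft_ae_eq_of_tendsto hf (memLp_cft hg).1 (integrable_truncate hg) (memLp_truncate hg)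
    ?_ (tendsto_eLpNorm_cft_sub_truncate hg)
  exact (tendsto_eLpNorm_sub_truncate hg).congr fun R =>
    (eLpNorm_congr_ae (hfg.sub EventuallyEq.rfl)).symm

theorem cft_clm_comp {f : E n → Cl n} (hf : MemLp f 2 volume) (A : Cl n →L[ℝ] Cl n)
    (hA : ∀ M t, A (M * expI n t) = A M * expI n t) :
    cft (fun x => A (f x)) =ᵐ[volume] fun ω => A (cft f ω) := by
  have hcomm {u : E n → Cl n} (hu : Integrable u) :
      cftIntegral (fun x => A (u x)) = fun ω => A (cftIntegral u ω) := by
    ext ω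
    simp only [cftIntegral, ← hA]
    exact A.integral_comp_comm
      (integrable_mul_expI hu (Continuous.aestronglyMeasurable (by fun_prop)))
  refine cft_ae_eq_of_tendsto (A.comp_memLp' hf) (A.comp_memLp' (memLp_cft hf)).1
    (l := atTop) (u := fun R x => A (truncate f R x))
    (fun R => A.integrable_comp (integrable_truncate hf R))
    (fun R => A.comp_memLp' (memLp_truncate hf R)) ?_ ?_
  · simpa only [Pi.sub_apply, map_sub] using!
      tendsto_eLpNorm_clm_comp A (tendsto_eLpNorm_sub_truncate hf)
  · simp_rw [hcomm (integrable_truncate hf _)]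
    simpa only [Pi.sub_apply, map_sub] using!
      tendsto_eLpNorm_clm_comp A (tendsto_eLpNorm_cft_sub_truncate hf)

theorem cft_const_mul {f : E n → Cl n} (hf : MemLp f 2 volume) (M : Cl n) :
    cft (fun x => M * f x) =ᵐ[volume] fun ω => M * cft f ω :=
  cft_clm_comp hf (mulL n M) fun N _ => (mul_assoc M N _).symm

theorem cft_mul_const {f : E n → Cl n} (hf : MemLp f 2 volume) {D : Cl n}
    (hD : Commute D (pseudoscalar n)) :
    cft (fun x => f x * D) =ᵐ[volume] fun ω => cft f ω * D := by
  refine cft_clm_comp hf ((mulL n).flip D) fun N t => ?_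
  have hDt : Commute D (expI n t) := ((Commute.one_right D).smul_right _).add_right
    (hD.smul_right _)
  simp only [ContinuousLinearMap.flip_apply, mulL_apply, mul_assoc, hDt.eq]

theorem integral_inner_cft {f g : E n → Cl n} (hf : MemLp f 2 volume) (hg : MemLp g 2 volume) :
    ∫ ω, inner ℝ (cft f ω) (cft g ω) = (2 * Real.pi) ^ n * ∫ x, inner ℝ (f x) (g x) := by
  have hrep : ∫ ω, inner ℝ (cft f ω) (cft g ω) = ∫ ω, inner ℝ (cftRep hf ω) (cftRep hg ω) := by
    refine integral_congr_ae ?_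
    filter_upwards [cft_ae_eq_cftRep hf, cft_ae_eq_cftRep hg] with ω hfω hgω
    rw [hfω, hgω]
  rw [hrep]
  simp only [cftRep, real_inner_smul_left, real_inner_smul_right, ← mul_assoc]
  rw [integral_const_mul, ← sq, plancherelConst_sq, ← integral_inner_fourierL2 hf hg]
  exact congrArg _ (integral_bilin_daughter (innerSL ℝ) _ _ _)

theorem l2Inner_cft {f g : E n → Cl n} (hf : MemLp f 2 volume) (hg : MemLp g 2 volume) :
    l2Inner (cft f) (cft g) = ((2 * Real.pi) ^ n : ℝ) • l2Inner f g := by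
  have hinner (M F G : Cl n) :
      inner ℝ M (F * CliffordAlgebra.reverse G) = inner ℝ F (M * G) := by
    rw [← inner_mul_left, real_inner_comm]
  refine ext_inner_left ℝ fun M => ?_
  rw [inner_smul_right, l2Inner, l2Inner,
    ← integral_inner (integrable_mul_reverse (memLp_cft hf) (memLp_cft hg)),
    ← integral_inner (integrable_mul_reverse hf hg)]
  simp_rw [hinner]
  have hMg : MemLp (fun x => M * g x) 2 volume := (mulL n M).comp_memLp' hg
  rw [← integral_inner_cft hf hMg]
  refine integral_congr_ae ?_
  filter_upwards [cft_const_mul hg M] with ω hω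
  exact congrArg _ hω.symm

theorem cftIntegral_daughter {u : E n → Cl n} (hu : Integrable u) (g : SIM n) (ω : E n) :
    cftIntegral (daughter u g) ω =
      daughter (cftIntegral u) (dualDilation g.1) ω * expI n (-inner ℝ ω g.2) := by
  obtain ⟨⟨a, r⟩, b⟩ := g
  have hphase (x : E n) : inner ℝ ω x =
      inner ℝ ((a : ℝ) • rotate r⁻¹ ω) ((similitude ((a, r), b)).symm x) + inner ℝ ω b := by
    conv_lhs => rw [← (similitude ((a, r), b)).apply_symm_apply x]
    rw [similitude_apply, inner_add_right, real_inner_smul_right, inner_rotate_right,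
      real_inner_smul_left]
  have hint := integrable_daughter (integrable_mul_expI hu
    (t := fun y => -inner ℝ ((a : ℝ) • rotate r⁻¹ ω) y)
    (Continuous.aestronglyMeasurable (by fun_prop))) ((a, r), b)
  have hintegral := integral_comp_similitude_symm
    (fun y => u y * expI n (-inner ℝ ((a : ℝ) • rotate r⁻¹ ω) y)) ((a, r), b)
  have hscale : (a : ℝ) ^ (-(n : ℝ) / 2) * (a : ℝ) ^ n = (a : ℝ) ^ ((n : ℝ) / 2) := by
    rw [← Real.rpow_natCast, ← Real.rpow_add a.2]
    congr 1
    ring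
  calc cftIntegral (daughter u ((a, r), b)) ω
      = ∫ x, (mulL n).flip (expI n (-inner ℝ ω b)) ((a : ℝ) ^ (-(n : ℝ) / 2) •
          (u ((similitude ((a, r), b)).symm x) * expI n
            (-inner ℝ ((a : ℝ) • rotate r⁻¹ ω) ((similitude ((a, r), b)).symm x)))) := by
        refine integral_congr_ae (ae_of_all _ fun x => ?_)
        simp only [daughter_apply, hphase x, neg_add, expI_add, ContinuousLinearMap.flip_apply,
          mulL_apply, smul_mul_assoc, mul_assoc]
    _ = daughter (cftIntegral u) (dualDilation (a, r)) ω * expI n (-inner ℝ ω b) := by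
        rw [ContinuousLinearMap.integral_comp_comm]
        · rw [integral_smul, hintegral, smul_smul, hscale, daughter_dualDilation]
          rfl
        · exact hint

theorem cft_daughter {ψ : E n → Cl n} (hψ : MemLp ψ 2 volume) (g : SIM n) :
    cft (daughter ψ g) =ᵐ[volume] fun ω =>
      daughter (cft ψ) (dualDilation g.1) ω * expI n (-inner ℝ ω g.2) := by
  have hsub (φ χ : E n → Cl n) (h : SIM n) : daughter φ h - daughter χ h = daughter (φ - χ) h := by
    ext x
    simp only [Pi.sub_apply, daughter_apply, smul_sub]
  refine cft_ae_eq_of_tendsto (l := atTop) (u := fun R => daughter (truncate ψ R) g)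
    (memLp_daughter hψ g) ?_ (fun R => integrable_daughter (integrable_truncate hψ R) g)
    (fun R => memLp_daughter (memLp_truncate hψ R) g) ?_ ?_
  · exact (memLp_daughter (memLp_cft hψ) _).1.mul
      (Continuous.aestronglyMeasurable (by fun_prop))
  · simpa only [hsub, eLpNorm_daughter] using tendsto_eLpNorm_sub_truncate hψ
  · refine (tendsto_eLpNorm_cft_sub_truncate hψ).congr fun R => ?_
    rw [← eLpNorm_daughter _ (dualDilation g.1), ← hsub]
    refine eLpNorm_congr_norm_ae (ae_of_all _ fun ω => ?_)
    rw [Pi.sub_apply, Pi.sub_apply, cftIntegral_daughter (integrable_truncate hψ R), ← sub_mul,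
      norm_mul_expI]

end CliffordFourier

section Symbol

variable {n : ℕ}

/-- The symbol `a^{n/2} ψ̂(a r⁻¹ ω)~` of the wavelet transform: in the frequency domain the wavelet
transform at scale and rotation `p = (a, r)` is right multiplication by it. -/
def symbol (ψ : E n → Cl n) (p : DilRot n) (ω : E n) : Cl n :=
  CliffordAlgebra.reverse (daughter (cft ψ) (dualDilation p) ω)

/-- The product of the Fourier transform of `f` with the symbol of the wavelet transform; up to a
constant it is the spectrum of `b ↦ T_ψ f(p, b)`. -/
def waveletSpectrum (ψ f : E n → Cl n) (p : DilRot n) (ω : E n) : Cl n := cft f ω * symbol ψ p ω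

theorem symbol_mul_reverse (ψ : E n → Cl n) (p : DilRot n) (ω : E n) :
    symbol ψ p ω * CliffordAlgebra.reverse (symbol ψ p ω) = admissibilityIntegrand ψ ω p := by
  rw [symbol, CliffordAlgebra.reverse_reverse, daughter_dualDilation, map_smul, smul_mul_smul_comm,
    ← Real.rpow_add p.1.2, add_halves, Real.rpow_natCast, admissibilityIntegrand]

theorem norm_symbol_sq (ψ : E n → Cl n) (p : DilRot n) (ω : E n) :
    ‖symbol ψ p ω‖ ^ 2 = scalarPart n (admissibilityIntegrand ψ ω p) := by
  rw [← symbol_mul_reverse, ← real_inner_self_eq_norm_sq]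
  rfl

theorem lintegral_enorm_symbol_sq {ν : Measure (SO n)} {ψ : E n → Cl n} {C : Cl n}
    (hψ : IsAdmissible ν ψ C) :
    ∀ᵐ ω : E n, ∫⁻ p, ‖symbol ψ p ω‖ₑ ^ 2 ∂(muMeasure ν) = ENNReal.ofReal (scalarPart n C) := by
  filter_upwards [hψ.integrable, hψ.integral_eq] with ω hint hC
  set s : Cl n →L[ℝ] ℝ := (scalarPart n).toContinuousLinearMap
  have hsymbol (p : DilRot n) : ‖symbol ψ p ω‖ ^ 2 = s (admissibilityIntegrand ψ ω p) :=
    norm_symbol_sq ψ p ω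
  simp_rw [← ofReal_norm, ← ENNReal.ofReal_pow (norm_nonneg _)]
  rw [← ofReal_integral_eq_lintegral_ofReal _ (ae_of_all _ fun p => sq_nonneg _)]
  · simp_rw [hsymbol]
    rw [s.integral_comp_comm hint, hC]
    rfl
  · simp_rw [hsymbol]
    exact s.integrable_comp hint

theorem integral_waveletSpectrum_mul_reverse {ν : Measure (SO n)} {ψ : E n → Cl n} {C : Cl n}
    (hψ : IsAdmissible ν ψ C) (f h : E n → Cl n) :
    ∀ᵐ ω : E n, ∫ p, waveletSpectrum ψ f p ω *
        CliffordAlgebra.reverse (waveletSpectrum ψ h p ω) ∂(muMeasure ν) =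
      cft f ω * C * CliffordAlgebra.reverse (cft h ω) := by
  filter_upwards [hψ.integrable, hψ.integral_eq] with ω hint hC
  have hfactor (p : DilRot n) :
      waveletSpectrum ψ f p ω * CliffordAlgebra.reverse (waveletSpectrum ψ h p ω) =
        ((mulL n).flip (CliffordAlgebra.reverse (cft h ω)) ∘L mulL n (cft f ω))
          (admissibilityIntegrand ψ ω p) := by
    rw [← symbol_mul_reverse]
    simp only [waveletSpectrum, CliffordAlgebra.reverse.map_mul, ContinuousLinearMap.comp_apply,
      ContinuousLinearMap.flip_apply, mulL_apply, mul_assoc]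
  simp_rw [hfactor]
  rw [ContinuousLinearMap.integral_comp_comm _ hint, hC]
  rfl

variable [hn : Fact (n % 4 = 2 ∨ n % 4 = 3)]

theorem memLp_symbol {ψ : E n → Cl n} (hψ : MemLp ψ 2 volume) (p : DilRot n) :
    MemLp (symbol ψ p) 2 volume :=
  (reverseL n).toContinuousLinearMap.comp_memLp' (memLp_daughter (memLp_cft hψ) _)

theorem aestronglyMeasurable_symbol {ψ : E n → Cl n} (hψ : MemLp ψ 2 volume)
    (μ : Measure (DilRot n)) :
    AEStronglyMeasurable (fun q : DilRot n × E n => symbol ψ q.1 q.2) (μ.prod volume) :=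
  (continuous_reverse n).comp_aestronglyMeasurable
    (aestronglyMeasurable_uncurry_daughter (memLp_cft hψ).1 μ measurable_dualDilation)

theorem integrable_waveletSpectrum {ψ f : E n → Cl n} (hψ : MemLp ψ 2 volume)
    (hf : MemLp f 2 volume) (p : DilRot n) : Integrable (waveletSpectrum ψ f p) :=
  memLp_one_iff_integrable.1 ((mulL n).memLp_of_bilin 1 (memLp_cft hf) (memLp_symbol hψ p))

theorem lintegral_enorm_sq_mul_enorm_symbol_sq {ν : Measure (SO n)} [SFinite ν]
    {ψ φ : E n → Cl n} {C : Cl n} (hψ : IsAdmissible ν ψ C) (hφ : AEStronglyMeasurable φ volume) :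
    ∫⁻ q, ‖φ q.2‖ₑ ^ 2 * ‖symbol ψ q.1 q.2‖ₑ ^ 2 ∂((muMeasure ν).prod volume) =
      eLpNorm φ 2 volume ^ 2 * ENNReal.ofReal (scalarPart n C) := by
  have hsymbol := aestronglyMeasurable_symbol hψ.memLp (muMeasure ν)
  refine (lintegral_prod_symm _
    ((hφ.comp_snd.enorm.pow_const 2).mul (hsymbol.enorm.pow_const 2))).trans ?_
  simp only [Pi.mul_apply]
  rw [eLpNorm_two_sq, ← lintegral_mul_const' _ _ ENNReal.ofReal_ne_top]
  refine lintegral_congr_ae ?_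
  filter_upwards [lintegral_enorm_symbol_sq hψ] with ω hω
  rw [lintegral_const_mul' _ _ (by finiteness), hω]

theorem memLp_waveletSpectrum {ν : Measure (SO n)} [SFinite ν] {ψ f : E n → Cl n} {C : Cl n}
    (hψ : IsAdmissible ν ψ C) (hf : MemLp f 2 volume) :
    MemLp (fun q : DilRot n × E n => waveletSpectrum ψ f q.1 q.2) 2
      ((muMeasure ν).prod volume) := by
  refine memLp_two_of_eLpNorm_sq ((memLp_cft hf).1.comp_snd.mul
    (aestronglyMeasurable_symbol hψ.memLp (muMeasure ν))) (ne_top_of_le_ne_top (b :=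
      ‖mulL n‖ₑ ^ 2 * (eLpNorm (cft f) 2 volume ^ 2 * ENNReal.ofReal (scalarPart n C))) ?_ ?_)
  · have := (memLp_cft hf).2
    finiteness
  · rw [eLpNorm_two_sq, ← lintegral_enorm_sq_mul_enorm_symbol_sq hψ (memLp_cft hf).1,
      ← lintegral_const_mul' _ _ (by finiteness)]
    refine lintegral_mono fun q => ?_
    rw [← mul_pow, ← mul_pow, ← mul_assoc]
    gcongr
    exact (mulL n).le_opENorm₂ _ _

theorem cft_mul_pseudoscalar {σ : ℤˣ} {ψ : E n → Cl n} (hψ : MemLp ψ 2 volume)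
    (hσ : ∀ᵐ x, ψ x * pseudoscalar n = σ • (pseudoscalar n * ψ x)) :
    ∀ᵐ ω, cft ψ ω * pseudoscalar n = σ • (pseudoscalar n * cft ψ ω) := by
  have hright : MemLp (fun x => ψ x * pseudoscalar n) 2 volume :=
    ((mulL n).flip (pseudoscalar n)).comp_memLp' hψ
  have hcongr : (fun x => ψ x * pseudoscalar n) =ᵐ[volume]
      fun x => (σ • pseudoscalar n) * ψ x := by
    filter_upwards [hσ] with x hx
    rw [hx, smul_mul_assoc]
  filter_upwards [cft_mul_const hψ (Commute.refl (pseudoscalar n)),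
    cft_const_mul hψ (σ • pseudoscalar n), cft_congr_ae hright hcongr] with ω hωr hωl hω
  rw [← hωr, hω, hωl, smul_mul_assoc]

theorem commute_reverse_mul_self {σ : ℤˣ} {M : Cl n}
    (hM : M * pseudoscalar n = σ • (pseudoscalar n * M)) :
    Commute (CliffordAlgebra.reverse M * M) (pseudoscalar n) := by
  have hrev : pseudoscalar n * CliffordAlgebra.reverse M =
      σ • (CliffordAlgebra.reverse M * pseudoscalar n) := by
    have h := congrArg CliffordAlgebra.reverse hM
    rcases Int.units_eq_one_or σ with rfl | rfl <;>
      simpa [CliffordAlgebra.reverse.map_mul, reverse_pseudoscalar hn.out, neg_eq_iff_eq_neg]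
        using h
  rw [commute_iff_eq, mul_assoc, hM, ← mul_assoc (pseudoscalar n), hrev, mul_smul_comm,
    smul_mul_assoc, mul_assoc]

theorem commute_admissibilityConstant {σ : ℤˣ} {ν : Measure (SO n)} [SFinite ν] {ψ : E n → Cl n}
    {C : Cl n} (hψ : IsAdmissible ν ψ C)
    (hσ : ∀ᵐ x, ψ x * pseudoscalar n = σ • (pseudoscalar n * ψ x)) :
    Commute C (pseudoscalar n) := by
  have hcft := (quasiMeasurePreserving_uncurry_similitude_symm (muMeasure ν)
    measurable_dualDilation).ae (cft_mul_pseudoscalar hψ.memLp hσ)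
  have hslice := Measure.ae_ae_of_ae_prod
    (Measure.measurePreserving_swap.quasiMeasurePreserving.ae hcft)
  obtain ⟨ω, hω, hint, hC⟩ := (hslice.and (hψ.integrable.and hψ.integral_eq)).exists
  have hcomm : (fun p => admissibilityIntegrand ψ ω p * pseudoscalar n) =ᵐ[muMeasure ν]
      fun p => pseudoscalar n * admissibilityIntegrand ψ ω p := by
    filter_upwards [hω] with p hp
    rw [similitude_symm_dualDilation] at hp
    exact (commute_reverse_mul_self hp).smul_left _
  calc C * pseudoscalar n = ∫ p, admissibilityIntegrand ψ ω p * pseudoscalar n ∂(muMeasure ν) := by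
        rw [← hC]
        exact (((mulL n).flip (pseudoscalar n)).integral_comp_comm hint).symm
    _ = ∫ p, pseudoscalar n * admissibilityIntegrand ψ ω p ∂(muMeasure ν) :=
        integral_congr_ae hcomm
    _ = pseudoscalar n * C := by
        rw [← hC]
        exact (mulL n (pseudoscalar n)).integral_comp_comm hint

end Symbol

section NegInvariant

variable {V G : Type*} [AddCommGroup V] [MeasurableSpace V] [MeasurableNeg V] {μ : Measure V}
  [μ.IsNegInvariant] [NormedAddCommGroup G]

theorem eLpNorm_comp_neg_units_smul {p : ENNReal} {F : V → G} (hF : AEStronglyMeasurable F μ)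
    (σ : ℤˣ) : eLpNorm (fun b => F (-(σ • b))) p μ = eLpNorm F p μ := by
  rcases Int.units_eq_one_or σ with rfl | rfl
  · simpa using! eLpNorm_comp_measurePreserving hF (Measure.measurePreserving_neg μ)
  · simp

theorem integral_comp_neg_units_smul [NormedSpace ℝ G] (F : V → G) (σ : ℤˣ) :
    ∫ b, F (-(σ • b)) ∂μ = ∫ b, F b ∂μ := by
  rcases Int.units_eq_one_or σ with rfl | rfl
  · simpa using integral_neg_eq_self F μ
  · simp

end NegInvariant

section WaveletTransform

variable {n : ℕ}

theorem aestronglyMeasurable_waveletTransform {ψ f : E n → Cl n}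
    (hψ : AEStronglyMeasurable ψ volume) (hf : AEStronglyMeasurable f volume)
    (μ : Measure (SIM n)) : AEStronglyMeasurable (waveletTransform ψ f) μ :=
  (hf.comp_snd.mul ((continuous_reverse n).comp_aestronglyMeasurable
    (aestronglyMeasurable_uncurry_daughter hψ μ measurable_id))).integral_prod_right'

variable [hn : Fact (n % 4 = 2 ∨ n % 4 = 3)]

theorem waveletTransform_eq_cftIntegral {σ : ℤˣ} {ψ f : E n → Cl n} (hψ : MemLp ψ 2 volume)
    (hσ : ∀ᵐ x, ψ x * pseudoscalar n = σ • (pseudoscalar n * ψ x)) (hf : MemLp f 2 volume)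
    (p : DilRot n) (b : E n) :
    waveletTransform ψ f (p, b) =
      ((2 * Real.pi) ^ n)⁻¹ • cftIntegral (waveletSpectrum ψ f p) (-(σ • b)) := by
  rw [waveletTransform, eq_inv_smul_iff₀ (by positivity), ← l2Inner_cft hf (memLp_daughter hψ _),
    l2Inner, cftIntegral]
  refine integral_congr_ae ?_
  filter_upwards [cft_daughter hψ (p, b),
    (quasiMeasurePreserving_similitude_symm (dualDilation p)).ae (cft_mul_pseudoscalar hψ hσ)]
    with ω hω hcomm
  have hdaughter : daughter (cft ψ) (dualDilation p) ω * pseudoscalar n =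
      σ • (pseudoscalar n * daughter (cft ψ) (dualDilation p) ω) := by
    rw [daughter_apply, smul_mul_assoc, mul_smul_comm, hcomm, smul_comm]
  have hphase : -(σ • -inner ℝ ω b) = -inner ℝ (-(σ • b)) ω := by
    rcases Int.units_eq_one_or σ with rfl | rfl <;> simp [real_inner_comm]
  rw [hω, mul_expI_of_mul_pseudoscalar hdaughter, CliffordAlgebra.reverse.map_mul, reverse_expI,
    hphase, ← mul_assoc, waveletSpectrum, symbol]

theorem eLpNorm_waveletTransform_prodMk {σ : ℤˣ} {ψ f : E n → Cl n} (hψ : MemLp ψ 2 volume)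
    (hσ : ∀ᵐ x, ψ x * pseudoscalar n = σ • (pseudoscalar n * ψ x)) (hf : MemLp f 2 volume)
    {p : DilRot n} (hp : MemLp (waveletSpectrum ψ f p) 2 volume) :
    eLpNorm (fun b => waveletTransform ψ f (p, b)) 2 volume =
      ‖((2 * Real.pi) ^ n)⁻¹‖ₑ * (‖plancherelConst n‖ₑ *
        eLpNorm (waveletSpectrum ψ f p) 2 volume) := by
  have hint := integrable_waveletSpectrum hψ hf p
  have hslice : (fun b => waveletTransform ψ f (p, b)) =
      ((2 * Real.pi) ^ n)⁻¹ • fun b => cftIntegral (waveletSpectrum ψ f p) (-(σ • b)) :=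
    funext (waveletTransform_eq_cftIntegral hψ hσ hf p)
  rw [hslice, eLpNorm_const_smul,
    eLpNorm_comp_neg_units_smul (continuous_cftIntegral hint).aestronglyMeasurable,
    ← eLpNorm_congr_ae (cft_ae_eq_cftIntegral hint hp), eLpNorm_cft hp]

theorem l2Inner_waveletTransform_prodMk {σ : ℤˣ} {ψ f h : E n → Cl n} (hψ : MemLp ψ 2 volume)
    (hσ : ∀ᵐ x, ψ x * pseudoscalar n = σ • (pseudoscalar n * ψ x)) (hf : MemLp f 2 volume)
    (hh : MemLp h 2 volume) {p : DilRot n} (hfp : MemLp (waveletSpectrum ψ f p) 2 volume)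
    (hhp : MemLp (waveletSpectrum ψ h p) 2 volume) :
    l2Inner (fun b => waveletTransform ψ f (p, b)) (fun b => waveletTransform ψ h (p, b)) =
      ((2 * Real.pi) ^ n)⁻¹ • l2Inner (waveletSpectrum ψ f p) (waveletSpectrum ψ h p) := by
  have hcft : l2Inner (cft (waveletSpectrum ψ f p)) (cft (waveletSpectrum ψ h p)) =
      l2Inner (cftIntegral (waveletSpectrum ψ f p)) (cftIntegral (waveletSpectrum ψ h p)) := by
    refine integral_congr_ae ?_
    filter_upwards [cft_ae_eq_cftIntegral (integrable_waveletSpectrum hψ hf p) hfp,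
      cft_ae_eq_cftIntegral (integrable_waveletSpectrum hψ hh p) hhp] with ω hfω hhω
    rw [hfω, hhω]
  simp_rw [l2Inner, waveletTransform_eq_cftIntegral hψ hσ hf p,
    waveletTransform_eq_cftIntegral hψ hσ hh p, map_smul, smul_mul_assoc, mul_smul_comm]
  rw [integral_smul, integral_smul, integral_comp_neg_units_smul (fun b =>
    cftIntegral (waveletSpectrum ψ f p) b *
      CliffordAlgebra.reverse (cftIntegral (waveletSpectrum ψ h p) b))]
  change _ • _ • l2Inner _ _ = _ • l2Inner _ _
  rw [← hcft, l2Inner_cft hfp hhp, inv_smul_smul₀ (by positivity)]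

theorem memLp_waveletTransform {σ : ℤˣ} {ν : Measure (SO n)} [SFinite ν] {ψ f : E n → Cl n}
    {C : Cl n} (hψ : IsAdmissible ν ψ C)
    (hσ : ∀ᵐ x, ψ x * pseudoscalar n = σ • (pseudoscalar n * ψ x)) (hf : MemLp f 2 volume) :
    MemLp (waveletTransform ψ f) 2 (simMeasure ν) := by
  have hmeas := aestronglyMeasurable_waveletTransform hψ.memLp.1 hf.1 (simMeasure ν)
  have hspec := memLp_waveletSpectrum hψ hf
  refine memLp_two_of_eLpNorm_sq hmeas ?_
  have hnorm : eLpNorm (waveletTransform ψ f) 2 (simMeasure ν) ^ 2 =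
      (‖((2 * Real.pi) ^ n)⁻¹‖ₑ * ‖plancherelConst n‖ₑ) ^ 2 *
        eLpNorm (fun q : DilRot n × E n => waveletSpectrum ψ f q.1 q.2) 2
          ((muMeasure ν).prod volume) ^ 2 := by
    rw [simMeasure, eLpNorm_two_sq_prod hmeas, eLpNorm_two_sq_prod hspec.1,
      ← lintegral_const_mul' _ _ (by finiteness)]
    refine lintegral_congr_ae ?_
    filter_upwards [ae_memLp_two_prodMk hspec] with p hp
    rw [eLpNorm_waveletTransform_prodMk hψ.memLp hσ hf hp, ← mul_assoc, mul_pow]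
  have := hspec.2
  rw [hnorm]
  finiteness

theorem integral_waveletTransform_mul_reverse {σ : ℤˣ} {ν : Measure (SO n)} [SFinite ν]
    {ψ f h : E n → Cl n} {C : Cl n} (hψ : IsAdmissible ν ψ C)
    (hσ : ∀ᵐ x, ψ x * pseudoscalar n = σ • (pseudoscalar n * ψ x)) (hf : MemLp f 2 volume)
    (hh : MemLp h 2 volume) :
    ∫ g, waveletTransform ψ f g * CliffordAlgebra.reverse (waveletTransform ψ h g) ∂(simMeasure ν) =
      l2Inner (fun x => f x * C) h := by
  have hfS := memLp_waveletSpectrum hψ hf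
  have hhS := memLp_waveletSpectrum hψ hh
  have hfC : MemLp (fun x => f x * C) 2 volume := ((mulL n).flip C).comp_memLp' hf
  have hslice : ∀ᵐ p ∂(muMeasure ν),
      l2Inner (fun b => waveletTransform ψ f (p, b)) (fun b => waveletTransform ψ h (p, b)) =
        ((2 * Real.pi) ^ n)⁻¹ • l2Inner (waveletSpectrum ψ f p) (waveletSpectrum ψ h p) := by
    filter_upwards [ae_memLp_two_prodMk hfS, ae_memLp_two_prodMk hhS] with p hfp hhp
    exact l2Inner_waveletTransform_prodMk hψ.memLp hσ hf hh hfp hhp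
  have hCf : ∀ᵐ ω, cft (fun x => f x * C) ω = cft f ω * C :=
    cft_mul_const hf (commute_admissibilityConstant hψ hσ)
  calc ∫ g, waveletTransform ψ f g *
        CliffordAlgebra.reverse (waveletTransform ψ h g) ∂(simMeasure ν)
      = ∫ p, l2Inner (fun b => waveletTransform ψ f (p, b))
          (fun b => waveletTransform ψ h (p, b)) ∂(muMeasure ν) :=
        integral_prod _ (integrable_mul_reverse (memLp_waveletTransform hψ hσ hf)
          (memLp_waveletTransform hψ hσ hh))
    _ = ((2 * Real.pi) ^ n)⁻¹ • ∫ p, l2Inner (waveletSpectrum ψ f p) (waveletSpectrum ψ h p)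
          ∂(muMeasure ν) := by rw [integral_congr_ae hslice, integral_smul]
    _ = ((2 * Real.pi) ^ n)⁻¹ • ∫ ω, ∫ p, waveletSpectrum ψ f p ω *
          CliffordAlgebra.reverse (waveletSpectrum ψ h p ω) ∂(muMeasure ν) :=
        congrArg _ (integral_integral_swap (integrable_mul_reverse hfS hhS))
    _ = ((2 * Real.pi) ^ n)⁻¹ • l2Inner (cft fun x => f x * C) (cft h) := by
        refine congrArg _ (integral_congr_ae ?_)
        filter_upwards [integral_waveletSpectrum_mul_reverse hψ f h, hCf] with ω hω hCω
        rw [hω, hCω]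
    _ = l2Inner (fun x => f x * C) h := by
        rw [l2Inner_cft hfC hh, inv_smul_smul₀ (by positivity)]

end WaveletTransform

section Kernel

variable {n : ℕ}

theorem kernel_eq_reverse_waveletTransform (ψ : E n → Cl n) (C : Cl n) (g g' : SIM n) :
    kernel ψ C g g' = CliffordAlgebra.reverse (waveletTransform ψ
      (fun x => daughter ψ g' x * CliffordAlgebra.reverse (Ring.inverse C)) g) := by
  rw [← reverseL_apply, waveletTransform, l2Inner, ← (reverseL n).integral_comp_comm]
  simp only [kernel, l2Inner, reverseL_apply, CliffordAlgebra.reverse.map_mul,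
    CliffordAlgebra.reverse_reverse, mul_assoc]

theorem l2Inner_mul_mul_reverse_inverse {C : Cl n} (hC : IsUnit C) (f h : E n → Cl n) :
    l2Inner (fun x => f x * C) (fun x => h x * CliffordAlgebra.reverse (Ring.inverse C)) =
      l2Inner f h := by
  simp only [l2Inner, CliffordAlgebra.reverse.map_mul, CliffordAlgebra.reverse_reverse, mul_assoc]
  simp only [← mul_assoc C, Ring.mul_inverse_cancel C hC, one_mul]

end Kernel

end CliffordWavelet

end

theorem mainTheorem5_general (n : ℕ) (hn : n % 4 = 2 ∨ n % 4 = 3)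
    (ν : Measure (SO n)) [SFinite ν]
    (ψ : E n → Cl n) (ε : ℤ) (hε : HasParity ψ ε) (C : Cl n) (hψ : IsAdmissible ν ψ C)
    (f : E n → Cl n) (hf : MemLp f 2 volume) :
    MemLp (waveletTransform ψ f) 2 (simMeasure ν) ∧
      ∀ g' : SIM n,
        MemLp (fun g => kernel ψ (signedConstant ε C) g g') 2 (simMeasure ν) ∧
        Integrable (fun g => waveletTransform ψ f g * kernel ψ (signedConstant ε C) g g')
          (simMeasure ν) ∧
        waveletTransform ψ f g' =
          ∫ g, waveletTransform ψ f g * kernel ψ (signedConstant ε C) g g' ∂(simMeasure ν) := by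
  have : Fact (n % 4 = 2 ∨ n % 4 = 3) := ⟨hn⟩
  obtain ⟨σ, hσ⟩ := hε.exists_ae_mul_pseudoscalar hn
  have hTf := memLp_waveletTransform hψ hσ hf
  refine ⟨hTf, fun g' => ?_⟩
  have hh : MemLp (fun x => daughter ψ g' x * CliffordAlgebra.reverse (Ring.inverse C)) 2 volume :=
    ((mulL n).flip (CliffordAlgebra.reverse (Ring.inverse C))).comp_memLp'
      (memLp_daughter hψ.memLp g')
  have hTh := memLp_waveletTransform hψ hσ hh
  simp_rw [hε.signedConstant_eq hn, kernel_eq_reverse_waveletTransform]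
  refine ⟨(reverseL n).toContinuousLinearMap.comp_memLp' hTh, integrable_mul_reverse hTf hTh, ?_⟩
  rw [integral_waveletTransform_mul_reverse hψ hσ hf hh, l2Inner_mul_mul_reverse_inverse hψ.isUnit,
    waveletTransform]

theorem mainTheorem5 (n : ℕ) (hn : n % 4 = 2 ∨ n % 4 = 3)
    (ν : Measure (SO n)) [ν.IsHaarMeasure]
    (ψ : E n → Cl n) (ε : ℤ) (hε : HasParity ψ ε) (C : Cl n) (hψ : IsAdmissible ν ψ C)
    (f : E n → Cl n) (hf : MemLp f 2 volume) :
    MemLp (waveletTransform ψ f) 2 (simMeasure ν) ∧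
      ∀ g' : SIM n,
        MemLp (fun g => kernel ψ (signedConstant ε C) g g') 2 (simMeasure ν) ∧
        Integrable (fun g => waveletTransform ψ f g * kernel ψ (signedConstant ε C) g g')
          (simMeasure ν) ∧
        waveletTransform ψ f g' =
          ∫ g, waveletTransform ψ f g * kernel ψ (signedConstant ε C) g g' ∂(simMeasure ν) :=
  mainTheorem5_general n hn ν ψ ε hε C hψ f hf
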